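/- **Setting.** Consider a finite two-player zero-sum stochastic game with states $1,\dots,n$, nonempty finite action sets $I^k,J^k$ in state $k$, stage payoff $g(k,i,j)\in\mathbb R$ and transition probabilities $q(\ell\mid k,i,j)$. At each stage $m\ge 1$ the players, knowing the past and the current state $k_m$, choose simultaneously actions $i_m\in I^{k_m}$, $j_m\in J^{k_m}$; the next state has law $q(\cdot\mid k_m,i_m,j_m)$. For $\lambda\in(0,1]$ let $v_\lambda^k$ be the value of the game with initial state $k$ in which Player 1 maximises (and Player 2 minimises) $\mathbb E\big[\sum_{m\ge1}\lambda(1-\lambda)^{m-1}g(k_m,i_m,j_m)\big]$, and $v_\lambda=(v_\lambda^1,\dots,v_\lambda^n)$. Let $g^-$ and $g^+$ be the minimum and the maximum of $g$. **Auxiliary matrices.** For $1\le k,\ell\le n$ define the $I^k\times J^k$ matrices $M^k_0=\lambda\,(g(k,i,j))_{i,j}$ and $M^k_\ell=(1-\lambda)\,(q(\ell\mid k,i,j))_{i,j}-\mathbf 1_{k=\ell}U$, where $U$ is the all-ones matrix. For an $n\times(n+1)$ array $D=(M^k_\ell)$ in which, for each $k$, the matrices $M^k_0,\dots,M^k_n$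 have the same size, and for $0\le\ell\le n$, put $\Delta^\ell=(-1)^\ell\det_\otimes D^{(\ell)}$, where $D^{(\ell)}$ is $D$ without the column $(M^k_\ell)_k$, and $\det_\otimes (A^k_l)_{k,l=1}^n=\sum_{\sigma}\epsilon(\sigma)A^1_{\sigma(1)}\otimes\cdots\otimes A^n_{\sigma(n)}$ (Kronecker products, sum over the permutations of $\{1,\dots,n\}$). **Kernels.** For a matrix game $G$, a *Shapley–Snow kernel* is a square sub-matrix $\dot G$ (rows $\dot I$, columns $\dot J$) for which there is an extreme point $(x,y)$ of the set of pairs of optimal mixed strategies of $G$ such that, writing $\mathrm{co}$ for the cofactor matrix, $S$ for the sum of entries, $\mathbf 1$ for the column vector of ones, and $\dot x=x|_{\dot I}$, $\dot y=y|_{\dot J}$: $S(\mathrm{co}(\dot G))\ne0$; $\dot x=\frac{\mathrm{co}(\dot G)}{S(\mathrm{co}(\dot G))}\mathbf 1$ and $\dot y=\frac{{}^t\mathrm{co}(\dot G)}{S(\mathrm{co}(\dot G))}\mathbf 1$; $\mathrm{val}(G)=\mathrm{val}(\dot G)=\frac{\det\dot G}{S(\mathrm{co}(\dot G))}$; ${}^t\dot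 x\,\dot G=\mathrm{val}(G)\,{}^t\mathbf 1$ and $\dot G\dot y=\mathrm{val}(G)\mathbf 1$. Given $\lambda_1\in(0,1]$, choose for every state $l$ a Shapley–Snow kernel of the local game $$\Big(\lambda_1 g(l,i,j)+(1-\lambda_1)\sum_{\ell=1}^n q(\ell\mid l,i,j)\,v_{\lambda_1}^\ell\Big)_{(i,j)\in I^l\times J^l},$$ with rows $\dot I^l$ and columns $\dot J^l$. Let $\dot\Delta^0$ be the real matrix obtained from the array $(\dot M^l_\ell)$ of the $\dot I^l\times\dot J^l$ sub-matrices of $M^l_\ell$ at $\lambda=\lambda_1$ in the same way as $\Delta^0$ is obtained from $(M^l_\ell)$. **The sets $E^k$ and $V^k$.** Let $E^k$ be the set of all determinants $P(\lambda,w)$ of square sub-matrices of $\Delta^k-w\Delta^0$, viewed as polynomials in the two indeterminates $(\lambda,w)$, that are not identically zero and have degree in $w$ at most $\operatorname{rank}(\dot\Delta^0)$. For $P\in E^k$ write $P(\lambda,w)=\sum_{s\ge 0}P_s(w)\lambda^s$ and let $\varphi(P)=P_s$ for the smallest $s$ with $P_s\not\equiv0$. Let $V^k$ be the set of all $w\in[g^-,g^+]$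 that are a root of $\varphi(P)$ for some $P\in E^k$. (The sets $E^k$ and $V^k$ depend on $\lambda_1$ and on the chosen kernels only through the number $\operatorname{rank}(\dot\Delta^0)$.) **Proposition.** For each state $k$ the limit $v_0^k:=\lim_{\lambda\to0}v_\lambda^k$ exists. Moreover there is $\lambda_0\in(0,1]$ such that for every $\lambda_1\in(0,\lambda_0)$ Shapley–Snow kernels as above exist, and for every choice of them at $\lambda_1$: every accumulation point of $v_\lambda^k$ as $\lambda\to0$ belongs to $V^k$, the set $V^k$ is finite, and $v_0^k\in V^k$. -/

import Mathlib

open Filter Topology Polynomial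

/-! ### Matrix games and their Shapley-Snow kernels -/

/-- The value `max_x min_y ᵗx G y` of the matrix game `G`, over mixed strategies. -/
noncomputable def gameVal {A B : Type*} [Fintype A] [Fintype B] (G : Matrix A B ℝ) : ℝ :=
  ⨆ x : stdSimplex ℝ A, ⨅ y : stdSimplex ℝ B, x.1 ⬝ᵥ (G.mulVec y.1)

/-- Optimal mixed strategies of the row player (the maximiser). -/
def optRow {A B : Type*} [Fintype A] [Fintype B] (G : Matrix A B ℝ) : Set (A → ℝ) :=
  {x | x ∈ stdSimplex ℝ A ∧ ∀ y ∈ stdSimplex ℝ B, gameVal G ≤ x ⬝ᵥ (G.mulVec y)}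

/-- Optimal mixed strategies of the column player (the minimiser). -/
def optCol {A B : Type*} [Fintype A] [Fintype B] (G : Matrix A B ℝ) : Set (B → ℝ) :=
  {y | y ∈ stdSimplex ℝ B ∧ ∀ x ∈ stdSimplex ℝ A, x ⬝ᵥ (G.mulVec y) ≤ gameVal G}

/-- The cofactor matrix (the adjugate is its transpose); it is `1` for a `1 × 1` matrix. -/
def coMatrix {m : ℕ} (M : Matrix (Fin m) (Fin m) ℝ) : Matrix (Fin m) (Fin m) ℝ :=
  M.adjugate.transpose

/-- The sum of the entries of a matrix. -/
def entrySum {m : ℕ} (M : Matrix (Fin m) (Fin m) ℝ) : ℝ := ∑ i, ∑ j, M i j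

/-- The square sub-matrix of `G` with rows `r` and columns `c` is a Shapley-Snow kernel of `G`:
for some basic solution `(x, y)`, an extreme point of the set of pairs of optimal strategies, the
four defining relations hold. The order in which `r` and `c` list the chosen actions
is irrelevant. The empty sub-matrix is excluded by `entrySum _ ≠ 0`. -/
def IsShapleySnowKernel {A B : Type*} [Fintype A] [Fintype B] (G : Matrix A B ℝ) {m : ℕ}
    (r : Fin m ↪ A) (c : Fin m ↪ B) : Prop :=
  ∃ (x : A → ℝ) (y : B → ℝ), (x, y) ∈ Set.extremePoints ℝ (optRow G ×ˢ optCol G) ∧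
    entrySum (coMatrix (G.submatrix r c)) ≠ 0 ∧
    (x ∘ r = (entrySum (coMatrix (G.submatrix r c)))⁻¹ •
        (coMatrix (G.submatrix r c)).mulVec (fun _ => 1)) ∧
    (y ∘ c = (entrySum (coMatrix (G.submatrix r c)))⁻¹ •
        (coMatrix (G.submatrix r c)).transpose.mulVec (fun _ => 1)) ∧
    gameVal G = gameVal (G.submatrix r c) ∧
    gameVal (G.submatrix r c) =
      (G.submatrix r c).det / entrySum (coMatrix (G.submatrix r c)) ∧
    Matrix.vecMul (x ∘ r) (G.submatrix r c) = (fun _ => gameVal G) ∧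
    (G.submatrix r c).mulVec (y ∘ c) = (fun _ => gameVal G)

/-! ### Kronecker determinants and auxiliary matrices -/

/-- The Kronecker product `A 1 ⊗ ⋯ ⊗ A n`. Its rows and columns are indexed by tuples
`(i_1, …, i_n)` and `(j_1, …, j_n)` instead of their rank in the lexicographic order. -/
def kroneckerProd {n : ℕ} {A B : Fin n → Type*} {R : Type*} [CommRing R]
    (M : ∀ k, Matrix (A k) (B k) R) : Matrix (∀ k, A k) (∀ k, B k) R :=
  Matrix.of fun i j => ∏ k, M k (i k) (j k)

/-- The Kronecker determinant `∑_σ ε(σ) M^1_{σ(1)} ⊗ ⋯ ⊗ M^n_{σ(n)}` of an `n × n` array. -/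
def kroneckerDet {n : ℕ} {A B : Fin n → Type*} {R : Type*} [CommRing R]
    (M : ∀ k, Fin n → Matrix (A k) (B k) R) : Matrix (∀ k, A k) (∀ k, B k) R :=
  ∑ σ : Equiv.Perm (Fin n), ((Equiv.Perm.sign σ : ℤ) : R) • kroneckerProd fun k => M k (σ k)

/-- The auxiliary matrix `Δ^ℓ` of an `n × (n+1)` array of matrices: delete the column of
index `ℓ`, take the Kronecker determinant, and multiply by `(-1)^ℓ`. -/
def auxMatrix {n : ℕ} {A B : Fin n → Type*} {R : Type*} [CommRing R]
    (D : ∀ k, Fin (n + 1) → Matrix (A k) (B k) R) (l : Fin (n + 1)) :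
    Matrix (∀ k, A k) (∀ k, B k) R :=
  (-1 : R) ^ (l : ℕ) • kroneckerDet fun k j => D k (l.succAbove j)

/-! ### Stochastic games -/

/-- A two-player zero-sum stochastic game with states `Fin n` and action sets `I k`, `J k` in
state `k`: stage payoffs `g` and transition probabilities `q k i j l = q(l | k, i, j)`. -/
structure StochasticGame (n : ℕ) (I J : Fin n → Type*) where
  g : ∀ k, I k → J k → ℝ
  q : ∀ k, I k → J k → Fin n → ℝ
  q_nonneg : ∀ k i j l, 0 ≤ q k i j l
  q_sum : ∀ k i j, ∑ l, q k i j l = 1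

/-- The triplets `(k, i, j)` of a state and a pair of actions available in it. -/
abbrev Triplet {n : ℕ} (I J : Fin n → Type*) := Σ k : Fin n, I k × J k

/-- A strategy of the player with action sets `A k`: after each finite sequence of past
triplets, and in each current state `k`, a mixed action in `A k`. -/
abbrev Strategy {n : ℕ} (I J : Fin n → Type*) (A : Fin n → Type*) [∀ k, Fintype (A k)] :=
  ∀ m : ℕ, (Fin m → Triplet I J) → ∀ k : Fin n, stdSimplex ℝ (A k)

namespace StochasticGame

/-- The probability that the next state is `l`, given the past triplets (the initial state
is `k₁`). -/
def stateProb {n : ℕ} {I J : Fin n → Type*} (Γ : StochasticGame n I J) (k₁ : Fin n) :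
    (m : ℕ) → (Fin m → Triplet I J) → Fin n → ℝ
  | 0, _, l => if l = k₁ then 1 else 0
  | m + 1, h, l => Γ.q (h (Fin.last m)).1 (h (Fin.last m)).2.1 (h (Fin.last m)).2.2 l

/-- The probability, under the strategies `σ` and `τ` and from the initial state `k₁`, of the
cylinder of plays whose first `m` triplets are `h`. -/
def cylinderProb {n : ℕ} {I J : Fin n → Type*} [∀ k, Fintype (I k)] [∀ k, Fintype (J k)]
    (Γ : StochasticGame n I J) (k₁ : Fin n) (σ : Strategy I J I) (τ : Strategy I J J) :
    (m : ℕ) → (Fin m → Triplet I J) → ℝ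
  | 0, _ => 1
  | m + 1, h =>
      Γ.cylinderProb k₁ σ τ m (Fin.init h) *
        (Γ.stateProb k₁ m (Fin.init h) (h (Fin.last m)).1 *
          (σ m (Fin.init h) (h (Fin.last m)).1).1 (h (Fin.last m)).2.1 *
          (τ m (Fin.init h) (h (Fin.last m)).1).1 (h (Fin.last m)).2.2)

/-- The expectation of the payoff of stage `m + 1`. -/
def stageExpectation {n : ℕ} {I J : Fin n → Type*} [∀ k, Fintype (I k)] [∀ k, Fintype (J k)]
    (Γ : StochasticGame n I J) (k₁ : Fin n) (σ : Strategy I J I) (τ : Strategy I J J)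
    (m : ℕ) : ℝ :=
  ∑ h : Fin (m + 1) → Triplet I J, Γ.cylinderProb k₁ σ τ (m + 1) h *
    Γ.g (h (Fin.last m)).1 (h (Fin.last m)).2.1 (h (Fin.last m)).2.2

/-- The expected `lam`-discounted payoff: the expectation of
`∑_{m ≥ 1} lam (1 - lam)^(m-1) g(k_m, i_m, j_m)`. The stage payoffs are bounded, so for
`lam ∈ (0, 1]` expectation and (absolutely convergent) sum commute. -/
noncomputable def payoff {n : ℕ} {I J : Fin n → Type*} [∀ k, Fintype (I k)]
    [∀ k, Fintype (J k)] (Γ : StochasticGame n I J) (lam : ℝ) (k₁ : Fin n)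
    (σ : Strategy I J I) (τ : Strategy I J J) : ℝ :=
  ∑' m : ℕ, lam * (1 - lam) ^ m * Γ.stageExpectation k₁ σ τ m

/-- The value of the `lam`-discounted game with initial state `k`. -/
noncomputable def value {n : ℕ} {I J : Fin n → Type*} [∀ k, Fintype (I k)]
    [∀ k, Fintype (J k)] (Γ : StochasticGame n I J) (lam : ℝ) (k : Fin n) : ℝ :=
  ⨆ σ : Strategy I J I, ⨅ τ : Strategy I J J, Γ.payoff lam k σ τ

/-- The local game at state `k` with continuation payoffs `z`. -/
def localGame {n : ℕ} {I J : Fin n → Type*} (Γ : StochasticGame n I J) (lam : ℝ)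
    (z : Fin n → ℝ) (k : Fin n) : Matrix (I k) (J k) ℝ :=
  Matrix.of fun i j => lam * Γ.g k i j + (1 - lam) * ∑ l, Γ.q k i j l * z l

/-- The data array: row `k` is `lam G^k, (1-lam) Q^k_1, …, (1-lam) Q^k_n`, with the all-ones
matrix subtracted from the entry `(1-lam) Q^k_k`. The discount factor may be a real number or
an indeterminate, whence the general ring of coefficients. -/
def dataArray {n : ℕ} {I J : Fin n → Type*} (Γ : StochasticGame n I J) {R : Type*} [CommRing R]
    [Algebra ℝ R] (lam : R) (k : Fin n) : Fin (n + 1) → Matrix (I k) (J k) R :=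
  Fin.cons (Matrix.of fun i j => lam * algebraMap ℝ R (Γ.g k i j))
    (fun l => Matrix.of fun i j =>
      (1 - lam) * algebraMap ℝ R (Γ.q k i j l) - if l = k then 1 else 0)

/-- A choice, at the discount factor `lam`, of a Shapley-Snow kernel of the local game at the
vector of values, for each state. -/
structure KernelChoice {n : ℕ} {I J : Fin n → Type*} [∀ k, Fintype (I k)]
    [∀ k, Fintype (J k)] (Γ : StochasticGame n I J) (lam : ℝ) where
  size : Fin n → ℕ
  row : ∀ k, Fin (size k) ↪ I k
  col : ∀ k, Fin (size k) ↪ J k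
  isKernel : ∀ k, IsShapleySnowKernel (Γ.localGame lam (Γ.value lam) k) (row k) (col k)

/-- The first auxiliary matrix of the reduced array that a choice of kernels defines. -/
def KernelChoice.reducedDelta0 {n : ℕ} {I J : Fin n → Type*} [∀ k, Fintype (I k)]
    [∀ k, Fintype (J k)] {Γ : StochasticGame n I J} {lam : ℝ} (κ : Γ.KernelChoice lam) :
    Matrix (∀ k, Fin (κ.size k)) (∀ k, Fin (κ.size k)) ℝ :=
  auxMatrix (fun k l => (Γ.dataArray lam k l).submatrix (κ.row k) (κ.col k)) 0

/-- The matrix `Δ^k - w Δ^0`, whose entries are polynomials in the discount factor and `w`.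
In `ℝ[X][X]` the discount factor is the outer indeterminate `X`, and `w` is the inner one,
`C X`. State `k` has the one-based label `k + 1`. -/
noncomputable def pencil {n : ℕ} {I J : Fin n → Type*} (Γ : StochasticGame n I J)
    (k : Fin n) : Matrix (∀ l, I l) (∀ l, J l) ℝ[X][X] :=
  auxMatrix (Γ.dataArray (X : ℝ[X][X])) k.succ -
    (C X : ℝ[X][X]) • auxMatrix (Γ.dataArray (X : ℝ[X][X])) 0

/-- The set `E^k`: the nonzero determinants of square sub-matrices of `Δ^k - w Δ^0`, of degree at
most the rank of the reduced `Δ^0` in the variable `w`. (Listing rows or columns in another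
order only changes the sign of a determinant.) -/
def charPolys {n : ℕ} {I J : Fin n → Type*} [∀ k, Fintype (I k)] [∀ k, Fintype (J k)]
    {Γ : StochasticGame n I J} {lam : ℝ} (κ : Γ.KernelChoice lam) (k : Fin n) :
    Set ℝ[X][X] :=
  {P | P ≠ 0 ∧ (∀ s, (P.coeff s).natDegree ≤ κ.reducedDelta0.rank) ∧
    ∃ (m : ℕ) (r : Fin m ↪ ∀ l, I l) (c : Fin m ↪ ∀ l, J l), 0 < m ∧
      P = ((Γ.pencil k).submatrix r c).det}

/-- The polynomial `φ(P)` in `w`: the coefficient `P_s(w)` of the lowest power of the discount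
factor whose coefficient is not the zero polynomial. -/
noncomputable def lowestCoeff (P : ℝ[X][X]) : ℝ[X] := P.trailingCoeff

/-- The smallest stage payoff. -/
noncomputable def minPayoff {n : ℕ} {I J : Fin n → Type*} (Γ : StochasticGame n I J) : ℝ :=
  ⨅ z : Triplet I J, Γ.g z.1 z.2.1 z.2.2

/-- The largest stage payoff. -/
noncomputable def maxPayoff {n : ℕ} {I J : Fin n → Type*} (Γ : StochasticGame n I J) : ℝ :=
  ⨆ z : Triplet I J, Γ.g z.1 z.2.1 z.2.2

/-- The set `V^k`: the roots in `[g⁻, g⁺]` of the polynomials `φ(P)`, for `P` in `E^k`. -/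
def rootSet {n : ℕ} {I J : Fin n → Type*} [∀ k, Fintype (I k)] [∀ k, Fintype (J k)]
    {Γ : StochasticGame n I J} {lam : ℝ} (κ : Γ.KernelChoice lam) (k : Fin n) : Set ℝ :=
  {w | w ∈ Set.Icc Γ.minPayoff Γ.maxPayoff ∧ ∃ P ∈ charPolys κ k, (lowestCoeff P).IsRoot w}

end StochasticGame

/-! ### Values and optimal strategies of matrix games -/

section MatrixGame

variable {A B : Type*} [Fintype A] [Fintype B]

/-! For fixed `λ` in `(0, 1]` the vector `v_λ` is the fixed point of the Shapley operator
(`gameVal_localGame_value`), so the local game in state `l`, shifted by its value, is `M^l_0 + ∑_ℓ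
v_λ^ℓ M^l_ℓ`. On a Shapley-Snow kernel this matrix is annihilated by the kernel strategies from both
sides. The states thus form a multiparameter eigenvalue problem, which tensor products decouple: the
products of the kernel strategies annihilate the reduced `Δ^k - v_λ^k Δ^0` on the left and on the
right (`auxMatrix_sub_smul_mulVec`, `vecMul_auxMatrix_sub_smul`). By diagonal dominance all entries
of `(-1)^n Δ^0` are positive, so the two product strategies pair to a nonzero number through the
reduced `Δ^0`. This forces a maximal nonzero minor of the reduced pencil, possibly rectangular in
rank, to vanish at `w = v_λ^k` (`exists_minor_root`). Its degree in `w` is at most the rank of the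
reduced `Δ^0`; since that rank is generic, hence maximal, for small `λ`, the bound holds for the
bivariate minor (`eventually_exists_charPoly_root`).

The rest is asymptotic and rests on there being finitely many minors. If `P(λ, f(λ)) = 0` for
arbitrarily small `λ` and `f(λ) → w`, then `φ(P)(w) = 0` (`lowestCoeff_isRoot`). Were `v_λ^k` to
oscillate across an interval, continuity in `λ` would make it take each interior value `c` for
arbitrarily small `λ`, so every `c` would be a root of one of finitely many nonzero polynomials
`φ(P)`; hence the limit exists (`exists_tendsto_value`). It lies in `V^k` by a pigeonhole on the
minors, for each rank that recurs as `λ → 0` (`eventually_limit_mem_rootSet`).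

Kernels exist because extremality makes the supports of an optimal pair index independent rows and
columns of a shifted game, which extend to a nonsingular square block (`exists_shapleySnowKernel`).
-/

lemma continuous_dotProduct_mulVec (G : Matrix A B ℝ) :
    Continuous fun p : (A → ℝ) × (B → ℝ) => p.1 ⬝ᵥ (G.mulVec p.2) := by
  simp only [dotProduct, Matrix.mulVec]
  fun_prop

lemma bddBelow_range_payoff (G : Matrix A B ℝ) (x : A → ℝ) :
    BddBelow (Set.range fun y : stdSimplex ℝ B => x ⬝ᵥ (G.mulVec y.1)) := by
  have : CompactSpace (stdSimplex ℝ B) := isCompact_iff_compactSpace.mp (isCompact_stdSimplex ℝ B)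
  refine (isCompact_range ?_).bddBelow
  exact (continuous_dotProduct_mulVec G).comp (by fun_prop : Continuous
    fun y : stdSimplex ℝ B => (x, (y : B → ℝ)))

lemma gameVal_eq_of_saddle {G : Matrix A B ℝ} {v : ℝ} {x₀ : A → ℝ} {y₀ : B → ℝ}
    (hx₀ : x₀ ∈ stdSimplex ℝ A) (hy₀ : y₀ ∈ stdSimplex ℝ B)
    (hx : ∀ y ∈ stdSimplex ℝ B, v ≤ x₀ ⬝ᵥ (G.mulVec y))
    (hy : ∀ x ∈ stdSimplex ℝ A, x ⬝ᵥ (G.mulVec y₀) ≤ v) : gameVal G = v := by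
  have : Nonempty (stdSimplex ℝ A) := ⟨⟨x₀, hx₀⟩⟩
  have : Nonempty (stdSimplex ℝ B) := ⟨⟨y₀, hy₀⟩⟩
  have key : ∀ x : stdSimplex ℝ A, (⨅ y : stdSimplex ℝ B, x.1 ⬝ᵥ (G.mulVec y.1)) ≤ v := fun x =>
    (ciInf_le (bddBelow_range_payoff G x.1) ⟨y₀, hy₀⟩).trans (hy x.1 x.2)
  refine le_antisymm (ciSup_le key) ?_
  refine le_trans ?_ (le_ciSup (f := fun x : stdSimplex ℝ A =>
    ⨅ y : stdSimplex ℝ B, x.1 ⬝ᵥ (G.mulVec y.1)) ⟨v, ?_⟩ ⟨x₀, hx₀⟩)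
  · exact le_ciInf fun y => hx y.1 y.2
  · rintro _ ⟨x, rfl⟩
    exact key x

lemma stdSimplex_nonempty [Nonempty A] : (stdSimplex ℝ A).Nonempty := by
  classical
  exact ⟨_, single_mem_stdSimplex ℝ (Classical.arbitrary A)⟩

lemma exists_saddle [Nonempty A] [Nonempty B] (G : Matrix A B ℝ) :
    ∃ x₀ ∈ stdSimplex ℝ A, ∃ y₀ ∈ stdSimplex ℝ B, ∀ x ∈ stdSimplex ℝ A, ∀ y ∈ stdSimplex ℝ B,
      x ⬝ᵥ (G.mulVec y₀) ≤ x₀ ⬝ᵥ (G.mulVec y) := by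
  -- The minimiser's strategy is the first variable here; bilinearity supplies quasiconvexity and
  -- quasiconcavity.
  obtain ⟨b, hb, a, ha, h⟩ := Sion.exists_isSaddlePointOn (X := stdSimplex ℝ B)
    (Y := stdSimplex ℝ A) (f := fun y x => x ⬝ᵥ (G.mulVec y)) stdSimplex_nonempty
    (convex_stdSimplex ℝ B) (isCompact_stdSimplex ℝ B)
    (fun x _ => ((continuous_dotProduct_mulVec G).comp
      (by fun_prop : Continuous fun y => (x, y))).lowerSemicontinuous.lowerSemicontinuousOn _)
    (fun x _ => (LinearMap.convexOn ((dotProductBilin ℝ ℝ x).comp G.mulVecLin)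
      (convex_stdSimplex ℝ B)).quasiconvexOn)
    (convex_stdSimplex ℝ A) stdSimplex_nonempty (isCompact_stdSimplex ℝ A)
    (fun y _ => ((continuous_dotProduct_mulVec G).comp
      (by fun_prop : Continuous fun x => (x, y))).upperSemicontinuous.upperSemicontinuousOn _)
    (fun y _ => (LinearMap.concaveOn ((dotProductBilin ℝ ℝ).flip (G.mulVec y))
      (convex_stdSimplex ℝ A)).quasiconcaveOn)
  exact ⟨a, ha, b, hb, fun x hx y hy => h y hy x hx⟩

lemma exists_optimal [Nonempty A] [Nonempty B] (G : Matrix A B ℝ) :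
    (optRow G).Nonempty ∧ (optCol G).Nonempty := by
  obtain ⟨x₀, hx₀, y₀, hy₀, h⟩ := exists_saddle G
  have hv : gameVal G = x₀ ⬝ᵥ (G.mulVec y₀) :=
    gameVal_eq_of_saddle hx₀ hy₀ (fun y hy => h x₀ hx₀ y hy) fun x hx => h x hx y₀ hy₀
  refine ⟨⟨x₀, hx₀, fun y hy => ?_⟩, ⟨y₀, hy₀, fun x hx => ?_⟩⟩
  · rw [hv]; exact h x₀ hx₀ y hy
  · rw [hv]; exact h x hx y₀ hy₀

lemma le_dotProduct_of_mem_stdSimplex {x f : A → ℝ} {v : ℝ} (hx : x ∈ stdSimplex ℝ A)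
    (h : ∀ i, v ≤ f i) : v ≤ x ⬝ᵥ f := by
  calc v = ∑ i, x i * v := by rw [← Finset.sum_mul, hx.2, one_mul]
    _ ≤ x ⬝ᵥ f := Finset.sum_le_sum fun i _ => mul_le_mul_of_nonneg_left (h i) (hx.1 i)

lemma dotProduct_le_of_mem_stdSimplex {x f : A → ℝ} {v : ℝ} (hx : x ∈ stdSimplex ℝ A)
    (h : ∀ i, f i ≤ v) : x ⬝ᵥ f ≤ v := by
  calc x ⬝ᵥ f ≤ ∑ i, x i * v :=
        Finset.sum_le_sum fun i _ => mul_le_mul_of_nonneg_left (h i) (hx.1 i)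
    _ = v := by rw [← Finset.sum_mul, hx.2, one_mul]

lemma mem_optRow_iff {G : Matrix A B ℝ} {x : A → ℝ} :
    x ∈ optRow G ↔ x ∈ stdSimplex ℝ A ∧ ∀ j, gameVal G ≤ (Matrix.vecMul x G) j := by
  classical
  refine and_congr_right fun hx => ⟨fun h j => ?_, fun h y hy => ?_⟩
  · have := h _ (single_mem_stdSimplex ℝ j)
    rwa [Matrix.dotProduct_mulVec, dotProduct_single_one] at this
  · rw [Matrix.dotProduct_mulVec, dotProduct_comm]
    exact le_dotProduct_of_mem_stdSimplex hy h

lemma mem_optCol_iff {G : Matrix A B ℝ} {y : B → ℝ} :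
    y ∈ optCol G ↔ y ∈ stdSimplex ℝ B ∧ ∀ i, (G.mulVec y) i ≤ gameVal G := by
  classical
  refine and_congr_right fun hy => ⟨fun h i => ?_, fun h x hx => ?_⟩
  · have := h _ (single_mem_stdSimplex ℝ i)
    rwa [single_one_dotProduct] at this
  · exact dotProduct_le_of_mem_stdSimplex hx h

/-- Play a row strategy optimal in `G` against a column strategy optimal in `H`. -/
lemma gameVal_le_add [Nonempty A] [Nonempty B] {G H : Matrix A B ℝ} {c : ℝ}
    (h : ∀ i j, G i j ≤ H i j + c) : gameVal G ≤ gameVal H + c := by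
  obtain ⟨x, hx⟩ := (exists_optimal G).1
  obtain ⟨y, hy⟩ := (exists_optimal H).2
  refine (hx.2 y hy.1).trans (le_trans ?_ (add_le_add_left (hy.2 x hx.1) c))
  rw [← sub_le_iff_le_add', ← dotProduct_sub, ← Matrix.sub_mulVec]
  refine dotProduct_le_of_mem_stdSimplex hx.1 fun i => ?_
  rw [Matrix.mulVec, dotProduct_comm]
  exact dotProduct_le_of_mem_stdSimplex hy.1 fun j => by
    simp only [Matrix.sub_apply]; linarith [h i j]

lemma abs_gameVal_sub_le [Nonempty A] [Nonempty B] {G H : Matrix A B ℝ} {c : ℝ}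
    (h : ∀ i j, |G i j - H i j| ≤ c) : |gameVal G - gameVal H| ≤ c := by
  rw [abs_le]
  constructor
  · have := gameVal_le_add (G := H) (H := G) (c := c) fun i j => by
      linarith [(abs_le.mp (h i j)).1]
    linarith
  · have := gameVal_le_add (G := G) (H := H) (c := c) fun i j => by
      linarith [(abs_le.mp (h i j)).2]
    linarith

lemma gameVal_le_of_le [Nonempty A] [Nonempty B] {G : Matrix A B ℝ} {c : ℝ}
    (h : ∀ i j, G i j ≤ c) : gameVal G ≤ c := by
  obtain ⟨x, hx⟩ := (exists_optimal G).1
  refine (hx.2 _ stdSimplex_nonempty.some_mem).trans ?_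
  refine dotProduct_le_of_mem_stdSimplex hx.1 fun i => ?_
  rw [Matrix.mulVec, dotProduct_comm]
  exact dotProduct_le_of_mem_stdSimplex stdSimplex_nonempty.some_mem (h i)

lemma le_gameVal_of_le [Nonempty A] [Nonempty B] {G : Matrix A B ℝ} {c : ℝ}
    (h : ∀ i j, c ≤ G i j) : c ≤ gameVal G := by
  obtain ⟨y, hy⟩ := (exists_optimal G).2
  refine le_trans ?_ (hy.2 _ stdSimplex_nonempty.some_mem)
  refine le_dotProduct_of_mem_stdSimplex stdSimplex_nonempty.some_mem fun i => ?_
  rw [Matrix.mulVec, dotProduct_comm]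
  exact le_dotProduct_of_mem_stdSimplex hy.1 (h i)

lemma isCompact_optRow (G : Matrix A B ℝ) : IsCompact (optRow G) := by
  have : optRow G = stdSimplex ℝ A ∩ {x | ∀ j, gameVal G ≤ (Matrix.vecMul x G) j} := by
    ext x; exact mem_optRow_iff
  rw [this]
  refine (isCompact_stdSimplex ℝ A).inter_right ?_
  simp only [Set.ofPred_forall]
  refine isClosed_iInter fun j => isClosed_le continuous_const ?_
  simp only [Matrix.vecMul, dotProduct]
  fun_prop

lemma isCompact_optCol (G : Matrix A B ℝ) : IsCompact (optCol G) := by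
  have : optCol G = stdSimplex ℝ B ∩ {y | ∀ i, (G.mulVec y) i ≤ gameVal G} := by
    ext x; exact mem_optCol_iff
  rw [this]
  refine (isCompact_stdSimplex ℝ B).inter_right ?_
  simp only [Set.ofPred_forall]
  refine isClosed_iInter fun j => isClosed_le ?_ continuous_const
  simp only [Matrix.mulVec, dotProduct]
  fun_prop

lemma exists_extreme_optimal [Nonempty A] [Nonempty B] (G : Matrix A B ℝ) :
    (Set.extremePoints ℝ (optRow G ×ˢ optCol G)).Nonempty :=
  ((isCompact_optRow G).prod (isCompact_optCol G)).extremePoints_nonempty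
    ((exists_optimal G).1.prod (exists_optimal G).2)

end MatrixGame

/-! ### Existence of Shapley-Snow kernels -/

section Cofactor

variable {m : ℕ}

/-- By Cramer's rule, entry `i` is the determinant with column `i` replaced by ones; adding `c` to
every other column is then a column operation. -/
lemma adjugate_add_const_mulVec_one (M : Matrix (Fin m) (Fin m) ℝ) (c : ℝ) :
    (M + Matrix.of fun _ _ => c).adjugate.mulVec (fun _ => 1) =
      M.adjugate.mulVec (fun _ => 1) := by
  rw [← Matrix.cramer_eq_adjugate_mulVec, ← Matrix.cramer_eq_adjugate_mulVec]
  ext i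
  rw [Matrix.cramer_apply, Matrix.cramer_apply, ← Matrix.det_transpose,
    ← Matrix.det_transpose (M.updateCol i _)]
  refine Matrix.det_eq_of_forall_row_eq_smul_add_const (fun j => if j = i then 0 else c) i
    (by simp) fun j l => ?_
  by_cases h : j = i
  · subst h; simp
  · simp [h]

lemma det_smul_eq_adjugate_mulVec {M : Matrix (Fin m) (Fin m) ℝ} {y : Fin m → ℝ} {v : ℝ}
    (h : M.mulVec y = fun _ => v) : M.det • y = v • M.adjugate.mulVec (fun _ => 1) := by
  have : M.adjugate.mulVec (M.mulVec y) = M.det • y := by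
    rw [Matrix.mulVec_mulVec, Matrix.adjugate_mul, Matrix.smul_mulVec, Matrix.one_mulVec]
  rw [← this, h, ← Matrix.mulVec_smul]
  congr 1
  ext; simp

lemma entrySum_coMatrix (M : Matrix (Fin m) (Fin m) ℝ) :
    entrySum (coMatrix M) = ∑ i, M.adjugate.mulVec (fun _ => 1) i := by
  simp only [entrySum, coMatrix, Matrix.transpose_apply, Matrix.mulVec, dotProduct, mul_one]
  exact Finset.sum_comm

lemma entrySum_coMatrix_transpose (M : Matrix (Fin m) (Fin m) ℝ) :
    entrySum (coMatrix M.transpose) = entrySum (coMatrix M) := by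
  simp only [entrySum, coMatrix, ← Matrix.adjugate_transpose, Matrix.transpose_apply]
  exact Finset.sum_comm

/-- A kernel may be singular (when its value is zero), so nonsingularity is asked only after adding
a constant. Summing Cramer's identity gives `det (M + cU) = (v + c) S` and `det M = v S` with `S`
the sum of cofactors; the first shows that `S` and `v + c` are nonzero and can be cancelled. -/
lemma cofactor_formula {M : Matrix (Fin m) (Fin m) ℝ} {y : Fin m → ℝ} {v c : ℝ}
    (hdet : (M + Matrix.of fun _ _ => c).det ≠ 0)
    (hy : ∑ i, y i = 1) (hM : M.mulVec y = fun _ => v) :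
    entrySum (coMatrix M) ≠ 0 ∧
      y = (entrySum (coMatrix M))⁻¹ • (coMatrix M).transpose.mulVec (fun _ => 1) ∧
      v = M.det / entrySum (coMatrix M) := by
  have hM' : (M + Matrix.of fun _ _ => c).mulVec y = fun _ => v + c := by
    rw [Matrix.add_mulVec, hM]
    ext i
    simp [Matrix.mulVec, dotProduct, ← Finset.mul_sum, hy]
  have h1 := det_smul_eq_adjugate_mulVec hM'
  rw [adjugate_add_const_mulVec_one] at h1
  have h2 : (M + Matrix.of fun _ _ => c).det = (v + c) * entrySum (coMatrix M) := by
    rw [entrySum_coMatrix, Finset.mul_sum]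
    calc _ = ∑ i, ((M + Matrix.of fun _ _ => c).det • y) i := by
          simp [← Finset.mul_sum, hy]
      _ = _ := by rw [h1]; simp
  have h3 : M.det = v * entrySum (coMatrix M) := by
    rw [entrySum_coMatrix, Finset.mul_sum]
    calc _ = ∑ i, (M.det • y) i := by simp [← Finset.mul_sum, hy]
      _ = _ := by rw [det_smul_eq_adjugate_mulVec hM]; simp
  rw [h2] at hdet
  have hS := right_ne_zero_of_mul hdet
  have hvc := left_ne_zero_of_mul hdet
  refine ⟨hS, ?_, by rw [h3]; field_simp⟩
  rw [h2, mul_smul] at h1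
  have h4 := smul_right_injective _ hvc h1
  rw [show (coMatrix M).transpose = M.adjugate from Matrix.transpose_transpose _,
    ← h4, smul_smul, inv_mul_cancel₀ hS, one_smul]

end Cofactor

/-! ### Extending independent rows and columns to a nonsingular square block. -/

section Extension

variable {A B : Type*}

/-- A column relation that holds on the rows `R` holds on their span, hence on all rows in `I`,
where the columns `C` are independent. -/
lemma eq_zero_of_span_rows (N : Matrix A B ℝ) {I R : Set A} {J C : Set B} (hC : C ⊆ J)
    [Fintype C] (hspan : (fun i (j : J) => N i j) '' I ⊆
      Submodule.span ℝ ((fun i (j : J) => N i j) '' R))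
    (hind : LinearIndepOn ℝ (fun j (i : I) => N i j) C) (c : C → ℝ)
    (h : ∀ i ∈ R, ∑ j : C, N i j * c j = 0) : c = 0 := by
  let φ : (J → ℝ) →ₗ[ℝ] ℝ := ∑ j : C, c j • LinearMap.proj (⟨j, hC j.2⟩ : J)
  have hφ : ∀ f, φ f = ∑ j : C, c j * f ⟨j, hC j.2⟩ := fun f => by simp [φ]
  have h1 : Submodule.span ℝ ((fun i (j : J) => N i j) '' R) ≤ LinearMap.ker φ := by
    rw [Submodule.span_le]
    rintro _ ⟨i, hi, rfl⟩
    simp only [SetLike.mem_coe, LinearMap.mem_ker, hφ]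
    simpa [mul_comm] using h i hi
  have h2 : ∀ i ∈ I, ∑ j : C, c j * N i j = 0 := fun i hi => by
    have := h1 (hspan ⟨i, hi, rfl⟩)
    rwa [LinearMap.mem_ker, hφ] at this
  have h3 := Fintype.linearIndependent_iff.mp hind c (by
    ext i
    simpa using h2 i i.2)
  exact funext h3

/-- Extend `I₁` to a row basis and `J₁` to a column basis of the block `I₂ × J₂`. The block they cut
out has trivial kernel on both sides, so it is square and nonsingular. -/
lemma exists_nonsingular_submatrix [Fintype A] [Fintype B] (N : Matrix A B ℝ) {I₁ I₂ : Set A}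
    {J₁ J₂ : Set B} (hI : I₁ ⊆ I₂) (hJ : J₁ ⊆ J₂)
    (hrow : LinearIndepOn ℝ (fun i (j : J₂) => N i j) I₁)
    (hcol : LinearIndepOn ℝ (fun j (i : I₂) => N i j) J₁) :
    ∃ (m : ℕ) (r : Fin m ↪ A) (c : Fin m ↪ B), I₁ ⊆ Set.range r ∧ Set.range r ⊆ I₂ ∧
      J₁ ⊆ Set.range c ∧ Set.range c ⊆ J₂ ∧ (N.submatrix r c).det ≠ 0 := by
  classical
  set R := hrow.extend hI
  set C := hcol.extend hJ
  have hR := hrow.extend_subset hI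
  have hC := hcol.extend_subset hJ
  have hr : ∀ c : C → ℝ, (∀ i ∈ R, ∑ j : C, N i j * c j = 0) → c = 0 :=
    eq_zero_of_span_rows N hC (hrow.image_subset_span_image_extend hI) (hcol.linearIndepOn_extend hJ)
  have hc : ∀ c : R → ℝ, (∀ j ∈ C, ∑ i : R, N i j * c i = 0) → c = 0 :=
    eq_zero_of_span_rows N.transpose hR (hcol.image_subset_span_image_extend hJ)
      (hrow.linearIndepOn_extend hI)
  let Q : Matrix R C ℝ := Matrix.of fun i j => N i j
  have h1 : Fintype.card C ≤ Fintype.card R := by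
    have : Function.Injective Q.mulVecLin := by
      rw [← LinearMap.ker_eq_bot, LinearMap.ker_eq_bot']
      intro c h
      exact hr c fun i hi => congrFun h ⟨i, hi⟩
    simpa using LinearMap.finrank_le_finrank_of_injective this
  have h2 : Fintype.card R ≤ Fintype.card C := by
    have : Function.Injective Q.transpose.mulVecLin := by
      rw [← LinearMap.ker_eq_bot, LinearMap.ker_eq_bot']
      intro c h
      exact hc c fun i hi => congrFun h ⟨i, hi⟩
    simpa using LinearMap.finrank_le_finrank_of_injective this
  let eR : Fin (Fintype.card R) ≃ R := (Fintype.equivFin R).symm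
  let eC : Fin (Fintype.card R) ≃ C := (Fintype.equivFinOfCardEq (le_antisymm h1 h2)).symm
  have rangeR : Set.range (fun i => (eR i : A)) = R := by
    rw [Set.range_comp' Subtype.val eR]; simp
  have rangeC : Set.range (fun i => (eC i : B)) = C := by
    rw [Set.range_comp' Subtype.val eC]; simp
  refine ⟨Fintype.card R, eR.toEmbedding.trans (Function.Embedding.subtype _),
    eC.toEmbedding.trans (Function.Embedding.subtype _), ?_, ?_, ?_, ?_, ?_⟩
  · exact (hrow.subset_extend hI).trans rangeR.superset
  · exact rangeR.subset.trans hR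
  · exact (hcol.subset_extend hJ).trans rangeC.superset
  · exact rangeC.subset.trans hC
  · intro h0
    obtain ⟨z, hz, hz0⟩ := Matrix.exists_mulVec_eq_zero_iff.mpr h0
    apply hz
    have := hr (z ∘ eC.symm) fun i hi => by
      have h3 := congrFun hz0 (eR.symm ⟨i, hi⟩)
      simp only [Matrix.mulVec, dotProduct, Matrix.submatrix_apply, Function.Embedding.trans_apply,
        Equiv.coe_toEmbedding, Equiv.apply_symm_apply, Function.Embedding.subtype_apply] at h3
      rw [← eC.sum_comp]
      simpa using h3
    ext i
    simpa using congrFun this (eC i)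

end Extension

/-! ### Extreme optimal strategies and the Shapley-Snow theorem. -/

section Kernel

variable {A B : Type*} [Fintype A] [Fintype B]

lemma exists_pos_mul_abs_le {f g : A → ℝ} (hf : ∀ i, 0 ≤ f i) (hfg : ∀ i, f i = 0 → g i = 0) :
    ∃ ε > 0, ∀ i, ε * |g i| ≤ f i := by
  have : ∀ᶠ ε in 𝓝[>] (0 : ℝ), ∀ i, ε * |g i| ≤ f i := by
    rw [Filter.eventually_all]
    intro i
    rcases (hf i).eq_or_lt with h | h
    · simp [hfg i h.symm, hf i]
    · have ht : Tendsto (fun ε : ℝ => ε * |g i|) (𝓝[>] 0) (𝓝 0) := by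
        have : Tendsto (fun ε : ℝ => ε * |g i|) (𝓝 0) (𝓝 (0 * |g i|)) :=
          (continuous_id.mul continuous_const).tendsto _
        rw [zero_mul] at this
        exact this.mono_left nhdsWithin_le_nhds
      exact (ht.eventually (gt_mem_nhds h)).mono fun _ => le_of_lt
  obtain ⟨ε, h1, h2⟩ := (this.and self_mem_nhdsWithin).exists
  exact ⟨ε, h2, h1⟩

lemma dotProduct_mulVec_eq_gameVal {G : Matrix A B ℝ} {x : A → ℝ} {y : B → ℝ}
    (hx : x ∈ optRow G) (hy : y ∈ optCol G) : x ⬝ᵥ (G.mulVec y) = gameVal G :=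
  le_antisymm (hy.2 x hx.1) (hx.2 y hy.1)

/-- Complementary slackness: the nonnegative terms `x i * (val G - (G y) i)` sum to zero. -/
lemma mulVec_eq_of_pos {G : Matrix A B ℝ} {x : A → ℝ} {y : B → ℝ}
    (hx : x ∈ optRow G) (hy : y ∈ optCol G) {i : A} (hi : x i ≠ 0) :
    (G.mulVec y) i = gameVal G := by
  have h0 : ∑ i, x i * (gameVal G - (G.mulVec y) i) = 0 := by
    have := dotProduct_mulVec_eq_gameVal hx hy
    simp only [mul_sub, Finset.sum_sub_distrib, ← Finset.sum_mul, hx.1.2, one_mul]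
    rw [sub_eq_zero, ← this, dotProduct]
  have h1 := (Finset.sum_eq_zero_iff_of_nonneg fun i _ => mul_nonneg (hx.1.1 i)
    (sub_nonneg.mpr ((mem_optCol_iff.mp hy).2 i))).mp h0 i (Finset.mem_univ i)
  rcases mul_eq_zero.mp h1 with h | h
  · exact absurd h hi
  · linarith

/-- Exchanging the players carries results about rows over to columns. -/
lemma gameVal_neg_transpose [Nonempty A] [Nonempty B] (G : Matrix A B ℝ) :
    gameVal (-G.transpose) = -gameVal G := by
  obtain ⟨x, hx⟩ := (exists_optimal G).1
  obtain ⟨y, hy⟩ := (exists_optimal G).2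
  have key : ∀ a : A → ℝ, ∀ b : B → ℝ,
      b ⬝ᵥ ((-G.transpose).mulVec a) = - (a ⬝ᵥ (G.mulVec b)) := fun a b => by
    rw [Matrix.neg_mulVec, dotProduct_neg, Matrix.mulVec_transpose, dotProduct_comm,
      Matrix.dotProduct_mulVec]
  refine gameVal_eq_of_saddle hy.1 hx.1 (fun a ha => ?_) fun b hb => ?_
  · rw [key]; exact neg_le_neg (hy.2 a ha)
  · rw [key]; exact neg_le_neg (hx.2 b hb)

lemma optRow_neg_transpose [Nonempty A] [Nonempty B] (G : Matrix A B ℝ) :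
    optRow (-G.transpose) = optCol G := by
  ext y
  rw [mem_optRow_iff, mem_optCol_iff, gameVal_neg_transpose]
  simp [Matrix.vecMul_neg, Matrix.vecMul_transpose]

lemma optCol_neg_transpose [Nonempty A] [Nonempty B] (G : Matrix A B ℝ) :
    optCol (-G.transpose) = optRow G := by
  ext y
  rw [mem_optRow_iff, mem_optCol_iff, gameVal_neg_transpose]
  simp [Matrix.neg_mulVec, Matrix.mulVec_transpose]

lemma vecMul_eq_of_pos [Nonempty A] [Nonempty B] {G : Matrix A B ℝ} {x : A → ℝ} {y : B → ℝ}
    (hx : x ∈ optRow G) (hy : y ∈ optCol G) {j : B} (hj : y j ≠ 0) :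
    (Matrix.vecMul x G) j = gameVal G := by
  rw [← optRow_neg_transpose] at hy
  rw [← optCol_neg_transpose] at hx
  have := mulVec_eq_of_pos hy hx hj
  simpa [gameVal_neg_transpose, Matrix.neg_mulVec, Matrix.mulVec_transpose] using this

/-- Pairing the relation with an optimal `y`, which is supported on the tight columns, leaves `s * ∑
c = 0` by complementary slackness. Hence `c` has zero sum and `c G` vanishes on the tight columns,
so `x ± ε c` remain optimal for small `ε`, and extremality gives `c = 0`. -/
lemma eq_zero_of_extreme [Nonempty A] [Nonempty B] {G : Matrix A B ℝ} {x : A → ℝ}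
    (hx : x ∈ Set.extremePoints ℝ (optRow G)) {s : ℝ} (hs : s ≠ 0) {c : A → ℝ}
    (hc : ∀ i, x i = 0 → c i = 0)
    (h : ∀ j, (Matrix.vecMul x G) j = gameVal G → ∑ i, c i * (G i j - gameVal G + s) = 0) :
    c = 0 := by
  obtain ⟨y, hy⟩ := (exists_optimal G).2
  have hxo := hx.1
  have hsum : ∑ i, c i = 0 := by
    have h1 : ∑ j, y j * ∑ i, c i * (G i j - gameVal G + s) = 0 :=
      Finset.sum_eq_zero fun j _ => by
        by_cases hj : y j = 0
        · simp [hj]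
        · rw [h j (vecMul_eq_of_pos hxo hy hj), mul_zero]
    have h2 : ∑ j, y j * ∑ i, c i * (G i j - gameVal G + s) =
        ∑ i, c i * ((G.mulVec y) i - gameVal G + s) := by
      simp only [Finset.mul_sum]
      rw [Finset.sum_comm]
      refine Finset.sum_congr rfl fun i _ => ?_
      calc _ = c i * (∑ j, G i j * y j - (∑ j, y j) * gameVal G + (∑ j, y j) * s) := by
            rw [Finset.sum_mul, Finset.sum_mul, ← Finset.sum_sub_distrib,
              ← Finset.sum_add_distrib, Finset.mul_sum]
            exact Finset.sum_congr rfl fun j _ => by ring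
        _ = _ := by rw [hy.1.2, one_mul, one_mul]; rfl
    have h3 : ∑ i, c i * ((G.mulVec y) i - gameVal G + s) = (∑ i, c i) * s := by
      rw [Finset.sum_mul]
      refine Finset.sum_congr rfl fun i _ => ?_
      by_cases hi : x i = 0
      · simp [hc i hi]
      · rw [mulVec_eq_of_pos hxo hy hi]; ring
    rw [h2, h3] at h1
    exact (mul_eq_zero.mp h1).resolve_right hs
  have hcG : ∀ j, (Matrix.vecMul x G) j = gameVal G → (Matrix.vecMul c G) j = 0 := fun j hj => by
    have h1 := h j hj
    have h2 : ∑ i, c i * (G i j - gameVal G + s) =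
        (Matrix.vecMul c G) j + (∑ i, c i) * (s - gameVal G) := by
      rw [Finset.sum_mul, Matrix.vecMul, dotProduct, ← Finset.sum_add_distrib]
      exact Finset.sum_congr rfl fun i _ => by ring
    rw [h2, hsum] at h1
    simpa using h1
  obtain ⟨ε₁, hε₁, h₁⟩ := exists_pos_mul_abs_le hxo.1.1 hc
  obtain ⟨ε₂, hε₂, h₂⟩ := exists_pos_mul_abs_le (f := fun j => (Matrix.vecMul x G) j - gameVal G)
    (g := Matrix.vecMul c G) (fun j => sub_nonneg.mpr ((mem_optRow_iff.mp hxo).2 j))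
    fun j hj => hcG j (sub_eq_zero.mp hj)
  have hmem : ∀ t : ℝ, |t| ≤ min ε₁ ε₂ → x + t • c ∈ optRow G := fun t ht => by
    rw [mem_optRow_iff]
    refine ⟨⟨fun i => ?_, ?_⟩, fun j => ?_⟩
    · have := (abs_mul t (c i)).trans_le ((mul_le_mul_of_nonneg_right
        (ht.trans (min_le_left _ _)) (abs_nonneg _)).trans (h₁ i))
      simp only [Pi.add_apply, Pi.smul_apply, smul_eq_mul]
      linarith [(abs_le.mp this).1]
    · simp [Finset.sum_add_distrib, ← Finset.mul_sum, hsum, hxo.1.2]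
    · have := (abs_mul t (Matrix.vecMul c G j)).trans_le ((mul_le_mul_of_nonneg_right
        (ht.trans (min_le_right _ _)) (abs_nonneg _)).trans (h₂ j))
      rw [Matrix.add_vecMul, Matrix.smul_vecMul]
      simp only [Pi.add_apply, Pi.smul_apply, smul_eq_mul]
      linarith [(abs_le.mp this).1]
  have hε : 0 < min ε₁ ε₂ := lt_min hε₁ hε₂
  have hp := hmem (min ε₁ ε₂) (abs_of_pos hε).le
  have hn := hmem (-min ε₁ ε₂) (by rw [abs_neg, abs_of_pos hε])
  have := hx.2 hp hn ⟨1 / 2, 1 / 2, by norm_num, by norm_num, by norm_num, by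
    ext i; simp; ring⟩
  have h5 : min ε₁ ε₂ • c = 0 := by simpa using this
  exact (smul_eq_zero.mp h5).resolve_left hε.ne'

lemma linearIndepOn_of_extreme [Nonempty A] [Nonempty B] {G : Matrix A B ℝ} {x : A → ℝ}
    (hx : x ∈ Set.extremePoints ℝ (optRow G)) {s : ℝ} (hs : s ≠ 0) :
    LinearIndepOn ℝ (fun i (j : {j | (Matrix.vecMul x G) j = gameVal G}) =>
      G i j - gameVal G + s) {i | x i ≠ 0} := by
  classical
  unfold LinearIndepOn
  rw [Fintype.linearIndependent_iff]
  intro c hc i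
  let c' : A → ℝ := fun i => if hi : x i ≠ 0 then c ⟨i, hi⟩ else 0
  have hc' : ∀ i : {i | x i ≠ 0}, c' i = c i := fun i => dif_pos i.2
  have hsub : ∀ f : A → ℝ, ∑ i, c' i * f i = ∑ i : {i | x i ≠ 0}, c i * f i := fun f => by
    simp only [← hc']
    refine (Finset.sum_subset (Finset.subset_univ (Finset.univ.filter fun i => x i ≠ 0))
      fun i _ hi => ?_).symm.trans (Finset.sum_subtype _ (by simp) _)
    rw [Finset.mem_filter] at hi
    have : x i = 0 := by simpa using hi
    simp [c', this]
  have h0 : c' = 0 := by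
    refine eq_zero_of_extreme hx hs (fun i hi => by simp [c', hi]) fun j hj => ?_
    rw [hsub]
    have := congrFun hc ⟨j, hj⟩
    simpa using this
  rw [← hc', h0, Pi.zero_apply]

lemma sum_comp_embedding {m : ℕ} (r : Fin m ↪ A) (f : A → ℝ)
    (h : {i | f i ≠ 0} ⊆ Set.range r) : ∑ i, f (r i) = ∑ a, f a := by
  rw [← Finset.sum_map Finset.univ r f]
  refine Finset.sum_subset (Finset.subset_univ _) fun a _ ha => ?_
  by_contra h0
  obtain ⟨i, rfl⟩ := h h0
  simp at ha

theorem exists_shapleySnowKernel [Nonempty A] [Nonempty B] (G : Matrix A B ℝ) :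
    ∃ (m : ℕ) (r : Fin m ↪ A) (c : Fin m ↪ B), IsShapleySnowKernel G r c := by
  obtain ⟨⟨x, y⟩, hxy⟩ := exists_extreme_optimal G
  have hxy' := hxy
  rw [extremePoints_prod] at hxy'
  obtain ⟨hx, hy⟩ : x ∈ Set.extremePoints ℝ (optRow G) ∧ y ∈ Set.extremePoints ℝ (optCol G) :=
    hxy'
  set v := gameVal G with hv
  let N : Matrix A B ℝ := Matrix.of fun i j => G i j - v + 1
  have hrow := linearIndepOn_of_extreme hx (one_ne_zero (α := ℝ))
  have hcol : LinearIndepOn ℝ (fun j (i : {i | (G.mulVec y) i = v}) => N i j) {j | y j ≠ 0} := by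
    -- The shift is `-1` because `-G.transpose` has value `-v`, and its entries shifted this way are
    -- the negatives of those of `N`.
    have h1 := linearIndepOn_of_extreme (G := -G.transpose) (x := y)
      (by rwa [optRow_neg_transpose]) (neg_ne_zero.mpr (one_ne_zero (α := ℝ)))
    have h2 : ∀ i, (Matrix.vecMul y (-G.transpose)) i = gameVal (-G.transpose) ↔
        (G.mulVec y) i = v := fun i => by
      simp [gameVal_neg_transpose, Matrix.vecMul_neg, Matrix.vecMul_transpose, hv]
    unfold LinearIndepOn at h1 ⊢
    rw [Fintype.linearIndependent_iff] at h1 ⊢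
    intro g hg
    refine h1 g ?_
    ext ⟨i, hi⟩
    have h3 := congrFun hg ⟨i, (h2 i).mp hi⟩
    rw [Finset.sum_apply, Pi.zero_apply] at h3 ⊢
    refine (Finset.sum_congr rfl fun j _ => ?_).trans
      ((Finset.sum_neg_distrib _).trans (neg_eq_zero.mpr h3))
    simp only [N, gameVal_neg_transpose, hv, Pi.smul_apply, smul_eq_mul, Matrix.neg_apply,
      Matrix.transpose_apply, Matrix.of_apply]
    ring
  obtain ⟨m, r, c, hr₁, hr₂, hc₁, hc₂, hdet⟩ := exists_nonsingular_submatrix N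
    (fun i hi => mulVec_eq_of_pos hx.1 hy.1 hi) (fun j hj => vecMul_eq_of_pos hx.1 hy.1 hj)
    hrow hcol
  have hsx : ∑ i, x (r i) = 1 := (sum_comp_embedding r x hr₁).trans hx.1.1.2
  have hsy : ∑ i, y (c i) = 1 := (sum_comp_embedding c y hc₁).trans hy.1.1.2
  have hGx : Matrix.vecMul (x ∘ r) (G.submatrix r c) = fun _ => v := by
    ext j
    have h1 := sum_comp_embedding r (fun i => x i * G i (c j)) fun i hi =>
      hr₁ (left_ne_zero_of_mul hi)
    exact h1.trans (hc₂ ⟨j, rfl⟩)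
  have hGy : (G.submatrix r c).mulVec (y ∘ c) = fun _ => v := by
    ext i
    have h1 := sum_comp_embedding c (fun j => G (r i) j * y j) fun j hj =>
      hc₁ (right_ne_zero_of_mul hj)
    exact h1.trans (hr₂ ⟨i, rfl⟩)
  -- The constant in the cofactor formula is `1 - v`, so the shifted block has value `1`.
  have hN : N.submatrix r c = G.submatrix r c + Matrix.of fun _ _ => 1 - v := by
    ext i j; simp [N]; ring
  rw [hN] at hdet
  have hdet' : ((G.submatrix r c).transpose + Matrix.of fun _ _ => 1 - v).det ≠ 0 := by
    rw [← Matrix.det_transpose]; exact hdet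
  obtain ⟨hS, hyc, hval⟩ := cofactor_formula hdet hsy hGy
  obtain ⟨-, hxr, -⟩ := cofactor_formula hdet' hsx (v := v) 
    (y := x ∘ r) (by rw [Matrix.mulVec_transpose, hGx])
  have hgv : gameVal (G.submatrix r c) = v := by
    refine gameVal_eq_of_saddle (x₀ := x ∘ r) (y₀ := y ∘ c) ⟨fun i => hx.1.1.1 _, hsx⟩
      ⟨fun i => hy.1.1.1 _, hsy⟩ (fun b hb => ?_) fun a ha => ?_
    · rw [Matrix.dotProduct_mulVec, hGx, dotProduct_comm]
      exact le_dotProduct_of_mem_stdSimplex hb fun _ => le_rfl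
    · rw [hGy]
      exact dotProduct_le_of_mem_stdSimplex ha fun _ => le_rfl
  refine ⟨m, r, c, x, y, hxy, hS, ?_, hyc, hgv.symm, hgv.trans hval, hGx, hGy⟩
  rw [entrySum_coMatrix_transpose] at hxr
  rwa [show (coMatrix (G.submatrix r c).transpose).transpose = coMatrix (G.submatrix r c) by
    rw [coMatrix, coMatrix, Matrix.adjugate_transpose, Matrix.transpose_transpose]] at hxr

end Kernel

/-! ### Maximal nonzero minors -/

section Minor

variable {A B : Type*} {R : Type*} [CommRing R]

lemma injective_of_det_submatrix_ne_zero {m : ℕ} {M : Matrix A B R} {r : Fin m → A}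
    {c : Fin m → B} (h : (M.submatrix r c).det ≠ 0) : r.Injective ∧ c.Injective := by
  constructor
  · intro i j hij
    by_contra hne
    exact h (Matrix.det_zero_of_row_eq hne (by ext l; simp [hij]))
  · intro i j hij
    by_contra hne
    exact h (Matrix.det_zero_of_column_eq hne (by intro l; simp [hij]))

/-- Taken just below the least size at which all minors vanish. Arbitrary index maps are allowed for
the larger minors, so bordering by a row or column already present needs no separate case. -/
lemma exists_maximal_minor [Fintype A] [Nontrivial R] (M : Matrix A B R) :
    ∃ (m : ℕ) (r : Fin m ↪ A) (c : Fin m ↪ B), (M.submatrix r c).det ≠ 0 ∧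
      ∀ (r' : Fin (m + 1) → A) (c' : Fin (m + 1) → B), (M.submatrix r' c').det = 0 := by
  classical
  have hex : ∃ m, ∀ (r : Fin m → A) (c : Fin m → B), (M.submatrix r c).det = 0 := by
    refine ⟨Fintype.card A + 1, fun r c => ?_⟩
    by_contra h
    have := Fintype.card_le_of_injective r (injective_of_det_submatrix_ne_zero h).1
    simp at this
  have hspec := Nat.find_spec hex
  -- Size zero is impossible, since the empty determinant is `1`.
  rcases hm : Nat.find hex with _ | m
  · rw [hm] at hspec
    simpa using hspec Fin.elim0 Fin.elim0
  · rw [hm] at hspec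
    have h := Nat.find_min hex (m := m) (by omega)
    push Not at h
    obtain ⟨r, c, hrc⟩ := h
    exact ⟨m, ⟨r, (injective_of_det_submatrix_ne_zero hrc).1⟩,
      ⟨c, (injective_of_det_submatrix_ne_zero hrc).2⟩, hrc, hspec⟩

/-- The minor bordered by row `i` and column `j` vanishes, and so does its Schur complement after
clearing denominators. -/
lemma det_mul_apply_of_maximal_minor [IsDomain R] {M : Matrix A B R} {m : ℕ} {r : Fin m → A}
    {c : Fin m → B} (h : (M.submatrix r c).det ≠ 0)
    (hmax : ∀ (r' : Fin (m + 1) → A) (c' : Fin (m + 1) → B), (M.submatrix r' c').det = 0)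
    (i : A) (j : B) :
    (M.submatrix r c).det * M i j =
      ∑ k, ∑ l, M i (c k) * (M.submatrix r c).adjugate k l * M (r l) j := by
  set Q := M.submatrix r c with hQ
  let b : Matrix (Fin m) Unit R := Matrix.of fun l _ => M (r l) j
  let a : Matrix Unit (Fin m) R := Matrix.of fun _ k => M i (c k)
  let d : Matrix Unit Unit R := Matrix.of fun _ _ => M i j
  let e : Fin (m + 1) ≃ Fin m ⊕ Unit :=
    finSumFinEquiv.symm.trans (Equiv.sumCongr (Equiv.refl _) finOneEquiv)
  have h1 : (Matrix.fromBlocks Q b a d).det = 0 := by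
    rw [← Matrix.det_submatrix_equiv_self e, ← hmax (Sum.elim r (fun _ => i) ∘ e)
      (Sum.elim c (fun _ => j) ∘ e)]
    congr 1
    ext k l
    simp only [Matrix.submatrix_apply, Function.comp_apply]
    rcases e k with k | k <;> rcases e l with l | l <;> rfl
  -- Division-free column elimination clears the upper right block.
  have h2 : Matrix.fromBlocks Q b a d *
      Matrix.fromBlocks 1 (-(Q.adjugate * b)) 0 (Q.det • 1) =
      Matrix.fromBlocks Q 0 a (Q.det • d - a * Q.adjugate * b) := by
    rw [Matrix.fromBlocks_multiply]
    congr 1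
    · simp
    · rw [Matrix.mul_neg, ← Matrix.mul_assoc, Matrix.mul_adjugate]
      simp
    · simp
    · rw [Matrix.mul_neg, ← Matrix.mul_assoc]
      simp [sub_eq_neg_add]
  have h3 := congrArg Matrix.det h2
  rw [Matrix.det_mul, h1, zero_mul, Matrix.det_fromBlocks_zero₁₂] at h3
  have h4 := (mul_eq_zero.mp h3.symm).resolve_left h
  rw [Matrix.det_unique, Matrix.sub_apply, sub_eq_zero] at h4
  simp only [Matrix.smul_apply, smul_eq_mul, Matrix.mul_apply, a, b, d, Matrix.of_apply,
    Finset.sum_mul] at h4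
  rw [h4, Finset.sum_comm]

end Minor

/-! ### Degrees and roots of minors of a matrix pencil. -/

section Rank

variable {A B : Type*} {K : Type*} [Field K]

lemma exists_minor_rank [Fintype A] [Fintype B] (M : Matrix A B K) :
    ∃ (r : Fin M.rank ↪ A) (c : Fin M.rank ↪ B) (F : Matrix (Fin M.rank) B K),
      (M.submatrix r c).det ≠ 0 ∧ M = M.submatrix id c * F := by
  obtain ⟨m, r, c, h, hmax⟩ := exists_maximal_minor M
  have hF : M = M.submatrix id c * ((M.submatrix r c).det⁻¹ •
      (M.submatrix r c).adjugate * M.submatrix r id) := by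
    ext i j
    rw [← mul_right_inj' h, det_mul_apply_of_maximal_minor h hmax, ← Matrix.mul_assoc,
      Matrix.mul_smul, Matrix.smul_mul, Matrix.smul_apply, smul_eq_mul, mul_inv_cancel_left₀ h]
    simp only [Matrix.mul_apply, Matrix.submatrix_apply, id, Finset.sum_mul]
    exact Finset.sum_comm
  have hrank : M.rank = m := by
    apply le_antisymm
    · calc M.rank ≤ (M.submatrix id c).rank := by
            conv_lhs => rw [hF]
            exact Matrix.rank_mul_le_left _ _
        _ ≤ m := by simpa using Matrix.rank_le_card_width (M.submatrix id c)
    · calc m = (M.submatrix r c).rank := by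
            rw [Matrix.rank_of_det_ne_zero h, Fintype.card_fin]
        _ ≤ M.rank := Matrix.rank_submatrix_le _ _ _
  subst hrank
  exact ⟨r, c, _, h, hF⟩

lemma card_le_rank_of_minor_ne_zero [Fintype B] {M : Matrix A B K} {m : ℕ} {r : Fin m → A}
    {c : Fin m → B} (h : (M.submatrix r c).det ≠ 0) : m ≤ M.rank :=
  calc m = (M.submatrix r c).rank := by rw [Matrix.rank_of_det_ne_zero h, Fintype.card_fin]
    _ ≤ M.rank := Matrix.rank_submatrix_le _ _ _

lemma natDegree_det_le_sum {ι : Type*} [Fintype ι] [DecidableEq ι] {R : Type*} [CommRing R]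
    {N : Matrix ι ι R[X]} {d : ι → ℕ} (h : ∀ i j, (N i j).natDegree ≤ d j) :
    N.det.natDegree ≤ ∑ j, d j := by
  rw [Matrix.det_apply]
  refine natDegree_sum_le_of_forall_le _ _ fun σ _ => ?_
  refine (natDegree_smul_le _ _).trans ((natDegree_prod_le _ _).trans ?_)
  exact Finset.sum_le_sum fun j _ => h _ _

/-- With a rank factorisation `B = E F`, the determinant is that of a block matrix in which `X`
occurs only in the columns of `X E`, which are `B.rank` in number. -/
lemma natDegree_det_sub_X_smul_le_rank {ι : Type*} [Fintype ι] [DecidableEq ι]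
    (A B : Matrix ι ι K) :
    (A.map C - (X : K[X]) • B.map C).det.natDegree ≤ B.rank := by
  obtain ⟨r, c, F, -, hF⟩ := exists_minor_rank B
  set E := B.submatrix id c
  have h1 : (A.map C - (X : K[X]) • B.map C).det =
      (Matrix.fromBlocks (A.map C) ((X : K[X]) • E.map C) (F.map C) 1).det := by
    rw [Matrix.det_fromBlocks_one₂₂, Matrix.smul_mul, ← Matrix.map_mul, ← hF]
  rw [h1]
  refine (natDegree_det_le_sum (d := Sum.elim (fun _ => 0) fun _ => 1) ?_).trans (by simp)
  rintro (i | i) (j | j)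
  · simp
  · simpa [smul_eq_mul] using (natDegree_mul_C_le X (E i j)).trans natDegree_X.le
  · simp
  · rw [Matrix.fromBlocks_apply₂₂, Matrix.one_apply]
    split_ifs <;> simp

lemma sum_sum_comm {ι κ : Type*} [Fintype A] [Fintype B] [Fintype ι] [Fintype κ] {R : Type*}
    [AddCommMonoid R] (f : A → B → ι → κ → R) :
    ∑ i, ∑ j, ∑ k, ∑ l, f i j k l = ∑ k, ∑ l, ∑ i, ∑ j, f i j k l := by
  calc _ = ∑ i, ∑ k, ∑ j, ∑ l, f i j k l := Finset.sum_congr rfl fun i _ => Finset.sum_comm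
    _ = ∑ k, ∑ i, ∑ j, ∑ l, f i j k l := Finset.sum_comm
    _ = ∑ k, ∑ i, ∑ l, ∑ j, f i j k l :=
      Finset.sum_congr rfl fun k _ => Finset.sum_congr rfl fun i _ => Finset.sum_comm
    _ = _ := Finset.sum_congr rfl fun k _ => Finset.sum_comm

/-- Let `P` be the pencil and `Q` a maximal nonzero minor block. Both `x P` and `P y` are divisible
by `w - X`, so substituting `det Q * P = P adj(Q) P` (suitable columns and rows) into `x P y` makes
the right side divisible by `(w - X)^2`. The left side is `det Q * (w - X)` times a nonzero
constant, so `w` is a root of `det Q`. -/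
lemma exists_minor_root [Fintype A] [Fintype B] {M N : Matrix A B K} {w : K} {x : A → K}
    {y : B → K} (hx : Matrix.vecMul x (M - w • N) = 0) (hy : (M - w • N).mulVec y = 0)
    (hxy : x ⬝ᵥ (N.mulVec y) ≠ 0) :
    ∃ (m : ℕ) (r : Fin m ↪ A) (c : Fin m ↪ B), 0 < m ∧
      ((M.map C - (X : K[X]) • N.map C).submatrix r c).det ≠ 0 ∧
      ((M.map C - (X : K[X]) • N.map C).submatrix r c).det.eval w = 0 := by
  set P := M.map C - (X : K[X]) • N.map C with hP
  obtain ⟨m, r, c, h, hmax⟩ := exists_maximal_minor P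
  have hPij : ∀ i j, P i j = C ((M - w • N) i j) + (C w - X) * C (N i j) := fun i j => by
    simp [hP]; ring
  have hxP : ∀ j, ∑ i, C (x i) * P i j = (C w - X) * C ((Matrix.vecMul x N) j) := fun j => by
    have h1 : ∑ i, x i * (M - w • N) i j = 0 := congrFun hx j
    simp only [hPij, mul_add, Finset.sum_add_distrib, ← C_mul, ← map_sum, h1]
    simp [Matrix.vecMul, dotProduct, Finset.mul_sum, mul_left_comm]
  have hyP : ∀ i, ∑ j, P i j * C (y j) = (C w - X) * C ((N.mulVec y) i) := fun i => by
    have h1 : ∑ j, (M - w • N) i j * y j = 0 := congrFun hy i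
    simp only [hPij, add_mul, Finset.sum_add_distrib, ← C_mul, ← map_sum, h1]
    simp [Matrix.mulVec, dotProduct, Finset.mul_sum, mul_assoc]
  set Q := P.submatrix r c with hQ
  have key : (C w - X) * (Q.det * C (x ⬝ᵥ N.mulVec y)) = (C w - X) * ((C w - X) *
      ∑ k, ∑ l, C ((Matrix.vecMul x N) (c k)) * Q.adjugate k l * C ((N.mulVec y) (r l))) := by
    calc _ = ∑ i, C (x i) * (Q.det * ∑ j, P i j * C (y j)) := by
          simp only [hyP, dotProduct, map_sum, C_mul, Finset.mul_sum]
          exact Finset.sum_congr rfl fun i _ => by ring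
      _ = ∑ i, ∑ j, C (x i) * (Q.det * P i j) * C (y j) := by
          simp only [Finset.mul_sum]
          exact Finset.sum_congr rfl fun i _ => Finset.sum_congr rfl fun j _ => by ring
      _ = ∑ i, ∑ j, ∑ k, ∑ l,
            (C (x i) * P i (c k)) * Q.adjugate k l * (P (r l) j * C (y j)) := by
          simp only [hQ, det_mul_apply_of_maximal_minor h hmax, Finset.mul_sum, Finset.sum_mul]
          refine Finset.sum_congr rfl fun i _ => Finset.sum_congr rfl fun j _ =>
            Finset.sum_congr rfl fun k _ => Finset.sum_congr rfl fun l _ => by ring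
      _ = ∑ k, ∑ l, (∑ i, C (x i) * P i (c k)) * Q.adjugate k l *
            (∑ j, P (r l) j * C (y j)) := by
          rw [sum_sum_comm]
          simp only [Finset.sum_mul, Finset.mul_sum]
          exact Finset.sum_congr rfl fun k _ => Finset.sum_congr rfl fun l _ => Finset.sum_comm
      _ = _ := by
          simp only [hxP, hyP, Finset.mul_sum]
          exact Finset.sum_congr rfl fun i _ => Finset.sum_congr rfl fun j _ => by ring
  have hne : (C w - X : K[X]) ≠ 0 := by
    rw [← neg_sub, neg_ne_zero]; exact X_sub_C_ne_zero w
  have h0 : Q.det.eval w = 0 := by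
    have := congrArg (eval w) (mul_left_cancel₀ hne key)
    simp only [eval_mul, eval_C, eval_sub, eval_X, sub_self, zero_mul, mul_eq_zero] at this
    exact this.resolve_right hxy
  refine ⟨m, r, c, ?_, h, h0⟩
  rcases Nat.eq_zero_or_pos m with rfl | hm
  · simp at h0
  · exact hm

end Rank

/-! ### Kronecker determinants and multiparameter eigenvalues -/

section Kronecker

variable {n : ℕ} {A B : Fin n → Type*} {R : Type*} [CommRing R]

lemma kroneckerDet_apply (M : ∀ k, Fin n → Matrix (A k) (B k) R) (i : ∀ k, A k) (j : ∀ k, B k) :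
    kroneckerDet M i j = (Matrix.of fun k l => M k l (i k) (j k)).det := by
  rw [← Matrix.det_transpose, Matrix.det_apply', kroneckerDet, Matrix.sum_apply]
  rfl

lemma auxMatrix_apply (D : ∀ k, Fin (n + 1) → Matrix (A k) (B k) R) (l : Fin (n + 1))
    (i : ∀ k, A k) (j : ∀ k, B k) :
    auxMatrix D l i j =
      (-1) ^ (l : ℕ) * (Matrix.of fun k l' => D k (l.succAbove l') (i k) (j k)).det := by
  rw [auxMatrix, Matrix.smul_apply, kroneckerDet_apply, smul_eq_mul]

lemma auxMatrix_map {S : Type*} [CommRing S] (φ : R →+* S)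
    (D : ∀ k, Fin (n + 1) → Matrix (A k) (B k) R) (l : Fin (n + 1)) :
    (auxMatrix D l).map φ = auxMatrix (fun k l' => (D k l').map φ) l := by
  ext i j
  rw [Matrix.map_apply, auxMatrix_apply, auxMatrix_apply, map_mul, map_pow, map_neg, map_one,
    RingHom.map_det]
  rfl

lemma auxMatrix_transpose (D : ∀ k, Fin (n + 1) → Matrix (A k) (B k) R) (l : Fin (n + 1)) :
    (auxMatrix D l).transpose = auxMatrix (fun k l' => (D k l').transpose) l := by
  ext i j
  rw [Matrix.transpose_apply, auxMatrix_apply, auxMatrix_apply]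
  rfl

lemma auxMatrix_submatrix {A' B' : Fin n → Type*} (D : ∀ k, Fin (n + 1) → Matrix (A k) (B k) R)
    (l : Fin (n + 1)) (r : ∀ k, A' k → A k) (c : ∀ k, B' k → B k) :
    auxMatrix (fun k l' => (D k l').submatrix (r k) (c k)) l =
      (auxMatrix D l).submatrix (Pi.map r) (Pi.map c) := by
  ext i j
  rw [Matrix.submatrix_apply, auxMatrix_apply, auxMatrix_apply]
  rfl

/-- The square matrix with first row `r` whose other rows are read off an array at the
position `(i, j)`. -/
def borderedArray (D : ∀ k, Fin (n + 1) → Matrix (A k) (B k) R) (r : Fin (n + 1) → R)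
    (i : ∀ k, A k) (j : ∀ k, B k) : Matrix (Fin (n + 1)) (Fin (n + 1)) R :=
  Matrix.of (Fin.cons r fun k l => D k l (i k) (j k))

/-- Laplace expansion along the first row, which is nonzero only at the positions `k.succ` and `0`.
-/
lemma auxMatrix_sub_smul_apply (D : ∀ k, Fin (n + 1) → Matrix (A k) (B k) R) (k : Fin n) (w : R)
    (i : ∀ k, A k) (j : ∀ k, B k) :
    (auxMatrix D k.succ - w • auxMatrix D 0) i j =
      (borderedArray D (Pi.single k.succ 1 - w • Pi.single 0 1) i j).det := by
  rw [Matrix.sub_apply, Matrix.smul_apply, auxMatrix_apply, auxMatrix_apply,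
    Matrix.det_succ_row_zero]
  have h : ∀ l : Fin (n + 1), ((borderedArray D (Pi.single k.succ 1 - w • Pi.single 0 1)
      i j).submatrix Fin.succ l.succAbove) =
      Matrix.of fun k l' => D k (l.succAbove l') (i k) (j k) := fun l => by
    ext; simp [borderedArray]
  have h0 : ∀ l : Fin (n + 1), borderedArray D (Pi.single k.succ 1 - w • Pi.single 0 1) i j 0 l =
      (Pi.single k.succ 1 : Fin (n + 1) → R) l - w * (Pi.single 0 1 : Fin (n + 1) → R) l :=
    fun l => by simp [borderedArray]
  simp only [h, h0, mul_sub, sub_mul, Finset.sum_sub_distrib]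
  congr 1
  · rw [Finset.sum_eq_single k.succ] <;> simp +contextual
  · rw [Finset.sum_eq_single 0] <;> simp +contextual

/-- Multilinearity in the rows: the row coming from state `k` depends on `j` only through `j k`. -/
lemma sum_det_borderedArray_mul [∀ k, Fintype (B k)]
    (D : ∀ k, Fin (n + 1) → Matrix (A k) (B k) R) (r : Fin (n + 1) → R) (i : ∀ k, A k)
    (y : ∀ k, B k → R) :
    ∑ j, (borderedArray D r i j).det * ∏ k, y k (j k) =
      (Matrix.of (Fin.cons r fun k l => ∑ b, D k l (i k) b * y k b)).det := by
  rw [← Matrix.det_transpose, Matrix.det_apply']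
  simp only [← Matrix.det_transpose (borderedArray D r i _), Matrix.det_apply', Finset.sum_mul]
  rw [Finset.sum_comm]
  refine Finset.sum_congr rfl fun σ _ => ?_
  simp only [Matrix.transpose_apply, borderedArray, Matrix.of_apply, Fin.prod_univ_succ,
    Fin.cons_zero, Fin.cons_succ, Finset.prod_univ_sum, Fintype.piFinset_univ, Finset.mul_sum,
    Finset.prod_mul_distrib]
  exact Finset.sum_congr rfl fun j _ => by ring

lemma auxMatrix_sub_smul_mulVec [IsDomain R] [∀ k, Fintype (B k)]
    {D : ∀ k, Fin (n + 1) → Matrix (A k) (B k) R} {y : ∀ k, B k → R} {v : Fin n → R}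
    (h : ∀ k i, ∑ b, (D k 0 i b + ∑ l : Fin n, v l * D k l.succ i b) * y k b = 0) (k : Fin n) :
    (auxMatrix D k.succ - v k • auxMatrix D 0).mulVec (fun j => ∏ k, y k (j k)) = 0 := by
  ext i
  rw [Matrix.mulVec, dotProduct]
  simp only [auxMatrix_sub_smul_apply, sum_det_borderedArray_mul]
  rw [Pi.zero_apply, ← Matrix.exists_mulVec_eq_zero_iff]
  -- The vector `(1, v)` is killed by the first row because `v k - v k * 1 = 0`, and by the others
  -- by hypothesis.
  refine ⟨Fin.cons 1 v, fun h0 => one_ne_zero (congrFun h0 0), ?_⟩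
  ext l
  rw [Matrix.mulVec, dotProduct, Fin.sum_univ_succ]
  refine Fin.cases ?_ (fun k' => ?_) l
  · simp [Pi.single_apply]
  · simp only [Matrix.of_apply, Fin.cons_succ, Fin.cons_zero, mul_one, Pi.zero_apply]
    rw [← h k' (i k')]
    simp only [add_mul, Finset.sum_add_distrib, Finset.sum_mul]
    congr 1
    rw [Finset.sum_comm]
    exact Finset.sum_congr rfl fun b _ => Finset.sum_congr rfl fun l _ => by ring

lemma vecMul_auxMatrix_sub_smul [IsDomain R] [∀ k, Fintype (A k)]
    {D : ∀ k, Fin (n + 1) → Matrix (A k) (B k) R} {x : ∀ k, A k → R} {v : Fin n → R}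
    (h : ∀ k j, ∑ a, (D k 0 a j + ∑ l : Fin n, v l * D k l.succ a j) * x k a = 0) (k : Fin n) :
    Matrix.vecMul (fun i => ∏ k, x k (i k)) (auxMatrix D k.succ - v k • auxMatrix D 0) = 0 := by
  rw [← Matrix.mulVec_transpose, Matrix.transpose_sub, Matrix.transpose_smul,
    auxMatrix_transpose, auxMatrix_transpose]
  exact auxMatrix_sub_smul_mulVec (D := fun k l => (D k l).transpose) h k

lemma prod_mem_stdSimplex [∀ k, Fintype (A k)] {x : ∀ k, A k → ℝ}
    (hx : ∀ k, x k ∈ stdSimplex ℝ (A k)) :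
    (fun i : ∀ k, A k => ∏ k, x k (i k)) ∈ stdSimplex ℝ (∀ k, A k) := by
  refine ⟨fun i => Finset.prod_nonneg fun k _ => (hx k).1 _, ?_⟩
  have := Finset.prod_univ_sum (fun _ => Finset.univ) x
  rw [Fintype.piFinset_univ] at this
  rw [← this]
  exact Finset.prod_eq_one fun k _ => (hx k).2

lemma dotProduct_pos_of_mem_stdSimplex {ι : Type*} [Fintype ι] {x f : ι → ℝ}
    (hx : x ∈ stdSimplex ℝ ι) (hf : ∀ i, 0 < f i) : 0 < x ⬝ᵥ f := by
  obtain ⟨i, -, hi⟩ : ∃ i ∈ Finset.univ, x i ≠ 0 := by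
    apply Finset.exists_ne_zero_of_sum_ne_zero
    rw [hx.2]
    exact one_ne_zero
  exact Finset.sum_pos' (fun j _ => mul_nonneg (hx.1 j) (hf j).le)
    ⟨i, Finset.mem_univ i, mul_pos ((hx.1 i).lt_of_ne' hi) (hf i)⟩

end Kronecker

/-- Strict diagonal dominance excludes zeros for parameters in `[0, 1)`, and the determinant is `1`
at parameter zero. -/
lemma det_one_sub_smul_pos {n : ℕ} {Q : Matrix (Fin n) (Fin n) ℝ} (h0 : ∀ k l, 0 ≤ Q k l)
    (h1 : ∀ k, ∑ l, Q k l = 1) {s : ℝ} (hs : s ∈ Set.Ico (0 : ℝ) 1) : 0 < (1 - s • Q).det := by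
  have hne : ∀ t ∈ Set.Ico (0 : ℝ) 1, (1 - t • Q).det ≠ 0 := fun t ht => by
    refine det_ne_zero_of_sum_row_lt_diag fun k => ?_
    have hk : Q k k + ∑ l ∈ Finset.univ.erase k, Q k l = 1 := by
      rw [Finset.add_sum_erase _ _ (Finset.mem_univ k), h1]
    have h2 : ∑ l ∈ Finset.univ.erase k, ‖(1 - t • Q) k l‖ =
        t * ∑ l ∈ Finset.univ.erase k, Q k l := by
      rw [Finset.mul_sum]
      refine Finset.sum_congr rfl fun l hl => ?_
      rw [Matrix.sub_apply, Matrix.one_apply_ne (Finset.ne_of_mem_erase hl).symm, zero_sub,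
        norm_neg, Matrix.smul_apply, smul_eq_mul, Real.norm_of_nonneg (mul_nonneg ht.1 (h0 k l))]
    rw [h2]
    refine lt_of_lt_of_le ?_ (Real.le_norm_self _)
    simp only [Matrix.sub_apply, Matrix.one_apply_eq, Matrix.smul_apply, smul_eq_mul]
    have : ∑ l ∈ Finset.univ.erase k, Q k l = 1 - Q k k := by linarith
    rw [this]
    linarith [ht.2]
  have hcont : Continuous fun t : ℝ => (1 - t • Q).det := by fun_prop
  by_contra! hle
  obtain ⟨t, ht, h3⟩ := intermediate_value_Icc' hs.1 hcont.continuousOn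
    (show (0 : ℝ) ∈ Set.Icc _ _ from ⟨hle, by simp⟩)
  exact hne t ⟨ht.1, ht.2.trans_lt hs.2⟩ h3

/-! ### Minors of the pencil that vanish at a discounted value. -/

namespace StochasticGame

variable {n : ℕ} {I J : Fin n → Type*} (Γ : StochasticGame n I J)

lemma neg_one_pow_mul_auxMatrix_zero_pos {lam : ℝ} (hlam : lam ∈ Set.Ioc (0 : ℝ) 1)
    (i : ∀ k, I k) (j : ∀ k, J k) : 0 < (-1) ^ n * auxMatrix (Γ.dataArray lam) 0 i j := by
  let Q : Matrix (Fin n) (Fin n) ℝ := Matrix.of fun k l => Γ.q k (i k) (j k) l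
  have h : (Matrix.of fun k l' => Γ.dataArray lam k ((0 : Fin (n + 1)).succAbove l') (i k) (j k)) =
      -(1 - (1 - lam) • Q) := by
    ext k l
    simp [dataArray, Q, Matrix.one_apply, eq_comm]
  rw [auxMatrix_apply, h, Matrix.det_neg, Fintype.card_fin, Fin.val_zero, pow_zero, one_mul,
    ← mul_assoc, ← mul_pow]
  simp only [neg_mul_neg, one_mul, one_pow]
  exact det_one_sub_smul_pos (Q := Q) (fun k l => Γ.q_nonneg _ _ _ _)
    (fun k => Γ.q_sum _ _ _) ⟨by linarith [hlam.2], by linarith [hlam.1]⟩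

lemma map_dataArray {R S : Type*} [CommRing R] [CommRing S] [Algebra ℝ R] [Algebra ℝ S]
    (φ : R →+* S) (hφ : ∀ a, φ (algebraMap ℝ R a) = algebraMap ℝ S a) (lam : R) (k : Fin n)
    (l : Fin (n + 1)) : (Γ.dataArray lam k l).map φ = Γ.dataArray (φ lam) k l := by
  refine Fin.cases ?_ (fun l => ?_) l
  · ext i j
    simp [dataArray, hφ]
  · ext i j
    simp [dataArray, hφ, apply_ite φ]

lemma map_eval_pencil (t : ℝ) (k : Fin n) :
    (Γ.pencil k).map (evalRingHom (C t)) =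
      (auxMatrix (Γ.dataArray t) k.succ).map C -
        (X : ℝ[X]) • (auxMatrix (Γ.dataArray t) 0).map C := by
  have h1 : ∀ l, (auxMatrix (Γ.dataArray (X : ℝ[X][X])) l).map (evalRingHom (C t)) =
      (auxMatrix (Γ.dataArray t) l).map C := fun l => by
    rw [auxMatrix_map, auxMatrix_map]
    congr 1
    ext1 k; ext1 l
    rw [map_dataArray _ _ (fun a => by simp),
      map_dataArray _ _ (fun a => by simp)]
    simp
  rw [← h1, ← h1, pencil]
  ext1 i j
  simp [Matrix.map_apply]

lemma map_eval_auxMatrix (t : ℝ) (l : Fin (n + 1)) :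
    (auxMatrix (Γ.dataArray (X : ℝ[X])) l).map (evalRingHom t) =
      auxMatrix (Γ.dataArray t) l := by
  rw [auxMatrix_map]
  congr 1
  ext1 k; ext1 l
  rw [map_dataArray _ _ fun a => by simp]
  simp

lemma eval_det_submatrix_pencil (t : ℝ) (k : Fin n) {m : ℕ} (r : Fin m → ∀ l, I l)
    (c : Fin m → ∀ l, J l) :
    ((Γ.pencil k).submatrix r c).det.eval (C t) =
      (((auxMatrix (Γ.dataArray t) k.succ).submatrix r c).map C -
        (X : ℝ[X]) • ((auxMatrix (Γ.dataArray t) 0).submatrix r c).map C).det := by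
  rw [← coe_evalRingHom, RingHom.map_det]
  congr 1
  have := map_eval_pencil Γ t k
  ext1 i j
  exact congrFun (congrFun this (r i)) (c j)

variable [∀ k, Fintype (I k)] [∀ k, Fintype (J k)]

/-- The minor is taken inside the kernel rows and columns, which is what bounds its degree by the
rank of the reduced `Δ^0`. The bound is stated at every `t`, with the block fixed, so that it can
later be passed to the bivariate polynomial. -/
lemma exists_minor_pencil_root {lam : ℝ} (hlam : lam ∈ Set.Ioc (0 : ℝ) 1) {v : Fin n → ℝ}
    (hv : ∀ k, gameVal (Γ.localGame lam v k) = v k) {size : Fin n → ℕ}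
    (row : ∀ k, Fin (size k) ↪ I k) (col : ∀ k, Fin (size k) ↪ J k)
    (hker : ∀ k, IsShapleySnowKernel (Γ.localGame lam v k) (row k) (col k)) (k : Fin n) :
    ∃ (m : ℕ) (r : Fin m ↪ ∀ l, I l) (c : Fin m ↪ ∀ l, J l), 0 < m ∧
      ((Γ.pencil k).submatrix r c).det ≠ 0 ∧
      (((Γ.pencil k).submatrix r c).det.eval (C lam)).eval (v k) = 0 ∧
      ∀ t : ℝ, (((Γ.pencil k).submatrix r c).det.eval (C t)).natDegree ≤
        ((auxMatrix (Γ.dataArray t) 0).submatrix (Pi.map fun k => row k)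
          (Pi.map fun k => col k)).rank := by
  choose x y hxy hS hx hy _ _ hxG hGy using hker
  set x' : ∀ k, Fin (size k) → ℝ := fun k => x k ∘ row k with hx'
  set y' : ∀ k, Fin (size k) → ℝ := fun k => y k ∘ col k with hy'
  have hxs : ∀ k, x' k ∈ stdSimplex ℝ (Fin (size k)) := fun k => by
    refine ⟨fun i => (hxy k).1.1.1.1 _, ?_⟩
    rw [show x' k = _ from hx k]
    simp only [Pi.smul_apply, smul_eq_mul, ← Finset.mul_sum]
    rw [inv_mul_eq_one₀ (hS k)]
    simp [entrySum, Matrix.mulVec, dotProduct]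
  have hys : ∀ k, y' k ∈ stdSimplex ℝ (Fin (size k)) := fun k => by
    refine ⟨fun i => (hxy k).1.2.1.1 _, ?_⟩
    rw [show y' k = _ from hy k]
    simp only [Pi.smul_apply, smul_eq_mul, ← Finset.mul_sum]
    rw [inv_mul_eq_one₀ (hS k)]
    exact entrySum_coMatrix _
  set D : ∀ k, Fin (n + 1) → Matrix (Fin (size k)) (Fin (size k)) ℝ :=
    fun k l => (Γ.dataArray lam k l).submatrix (row k) (col k) with hD
  have hDsum : ∀ k a b, D k 0 a b + ∑ l : Fin n, v l * D k l.succ a b =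
      Γ.localGame lam v k (row k a) (col k b) - v k := fun k a b => by
    simp only [hD, dataArray, Matrix.submatrix_apply, Fin.cons_zero, Fin.cons_succ,
      Matrix.of_apply, Algebra.algebraMap_self, RingHom.id_apply, localGame, mul_sub,
      Finset.sum_sub_distrib, Finset.mul_sum, mul_ite, mul_one, mul_zero,
      Finset.sum_ite_eq', Finset.mem_univ, if_true]
    rw [add_sub_assoc]
    congr 2
    exact Finset.sum_congr rfl fun l _ => by ring
  have hr := auxMatrix_sub_smul_mulVec (D := D) (y := y') (v := v) (fun k a => by
    simp only [hDsum, sub_mul, Finset.sum_sub_distrib, ← Finset.mul_sum, (hys k).2, mul_one]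
    rw [sub_eq_zero, ← hv k]
    exact congrFun (hGy k) a) k
  have hl := vecMul_auxMatrix_sub_smul (D := D) (x := x') (v := v) (fun k b => by
    simp only [hDsum, sub_mul, Finset.sum_sub_distrib, ← Finset.mul_sum, (hxs k).2, mul_one]
    rw [sub_eq_zero, ← hv k]
    refine Eq.trans ?_ (congrFun (hxG k) b)
    exact Finset.sum_congr rfl fun a _ => mul_comm _ _) k
  have hxs' := prod_mem_stdSimplex hxs
  have hys' := prod_mem_stdSimplex hys
  have hsub : ∀ l, auxMatrix D l = (auxMatrix (Γ.dataArray lam) l).submatrix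
      (Pi.map fun k => row k) (Pi.map fun k => col k) := fun l =>
    auxMatrix_submatrix (Γ.dataArray lam) l (fun k => row k) (fun k => col k)
  -- After the sign `(-1)^n`, this is an average of positive entries with the product strategies as
  -- weights.
  have hne : (fun i => ∏ k, x' k (i k)) ⬝ᵥ ((auxMatrix D 0).mulVec fun j => ∏ k, y' k (j k)) ≠ 0 := by
    have hpos : 0 < (fun i => ∏ k, x' k (i k)) ⬝ᵥ
        (((-1 : ℝ) ^ n • auxMatrix D 0).mulVec fun j => ∏ k, y' k (j k)) := by
      refine dotProduct_pos_of_mem_stdSimplex hxs' fun a => ?_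
      rw [Matrix.mulVec, dotProduct_comm]
      refine dotProduct_pos_of_mem_stdSimplex hys' fun b => ?_
      rw [hsub]
      exact Γ.neg_one_pow_mul_auxMatrix_zero_pos hlam _ _
    rw [Matrix.smul_mulVec, dotProduct_smul] at hpos
    exact right_ne_zero_of_mul hpos.ne'
  obtain ⟨m, r, c, hm, hdet, hroot⟩ := exists_minor_root hl hr hne
  have hr_inj : Function.Injective (Pi.map fun k => (row k : Fin (size k) → I k)) :=
    Function.Injective.piMap fun k => (row k).injective
  have hc_inj : Function.Injective (Pi.map fun k => (col k : Fin (size k) → J k)) :=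
    Function.Injective.piMap fun k => (col k).injective
  have heval : ((Γ.pencil k).submatrix (r.trans ⟨_, hr_inj⟩) (c.trans ⟨_, hc_inj⟩)).det.eval
      (C lam) = (((auxMatrix D k.succ).map C - (X : ℝ[X]) • (auxMatrix D 0).map C).submatrix
        r c).det := by
    rw [eval_det_submatrix_pencil, hsub, hsub]
    rfl
  refine ⟨m, r.trans ⟨_, hr_inj⟩, c.trans ⟨_, hc_inj⟩, hm, fun h0 => ?_, ?_, fun t => ?_⟩
  · rw [h0, eval_zero] at heval
    exact hdet heval.symm
  · rw [heval]; exact hroot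
  · rw [eval_det_submatrix_pencil]
    refine (natDegree_det_sub_X_smul_le_rank _ _).trans ?_
    exact Matrix.rank_submatrix_le ((auxMatrix (Γ.dataArray t) 0).submatrix
      (Pi.map fun k => row k) (Pi.map fun k => col k)) r c

end StochasticGame

/-! ### Shapley's theorem -/

namespace StochasticGame

variable {n : ℕ} {I J : Fin n → Type*} [∀ k, Fintype (I k)] [∀ k, Fintype (J k)]
  (Γ : StochasticGame n I J)

lemma abs_sum_mul_le {ι : Type*} [Fintype ι] {p f : ι → ℝ} {c : ℝ} (hp : ∀ i, 0 ≤ p i)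
    (hsum : ∑ i, p i = 1) (hf : ∀ i, |f i| ≤ c) : |∑ i, p i * f i| ≤ c := by
  have hps : p ∈ stdSimplex ℝ ι := ⟨hp, hsum⟩
  exact abs_le.mpr ⟨le_dotProduct_of_mem_stdSimplex hps fun i => (abs_le.mp (hf i)).1,
    dotProduct_le_of_mem_stdSimplex hps fun i => (abs_le.mp (hf i)).2⟩

/-! ### Expectations along plays and one-stage inequalities. -/

section Play

variable (k₁ : Fin n) (σ : Strategy I J I) (τ : Strategy I J J)

omit [∀ k, Fintype (I k)] [∀ k, Fintype (J k)] in
lemma stateProb_nonneg (m : ℕ) (h : Fin m → Triplet I J) (l : Fin n) :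
    0 ≤ Γ.stateProb k₁ m h l := by
  cases m with
  | zero => simp only [stateProb]; split_ifs <;> norm_num
  | succ m => exact Γ.q_nonneg _ _ _ _

omit [∀ k, Fintype (I k)] [∀ k, Fintype (J k)] in
lemma sum_stateProb (m : ℕ) (h : Fin m → Triplet I J) : ∑ l, Γ.stateProb k₁ m h l = 1 := by
  cases m with
  | zero => simp [stateProb]
  | succ m => exact Γ.q_sum _ _ _

lemma cylinderProb_nonneg (m : ℕ) (h : Fin m → Triplet I J) :
    0 ≤ Γ.cylinderProb k₁ σ τ m h := by
  induction m with
  | zero => exact zero_le_one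
  | succ m ih =>
    exact mul_nonneg (ih _) (mul_nonneg (mul_nonneg (Γ.stateProb_nonneg _ _ _ _)
      ((σ m _ _).2.1 _)) ((τ m _ _).2.1 _))

lemma cylinderProb_succ_eq {m : ℕ} {h : Fin m → Triplet I J} {t : Triplet I J}
    {h' : Fin (m + 1) → Triplet I J} (hinit : Fin.init h' = h) (hlast : h' (Fin.last m) = t) :
    Γ.cylinderProb k₁ σ τ (m + 1) h' = Γ.cylinderProb k₁ σ τ m h *
      (Γ.stateProb k₁ m h t.1 * (σ m h t.1).1 t.2.1 * (τ m h t.1).1 t.2.2) := by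
  subst hinit hlast
  rfl

lemma sum_cylinderProb_succ_mul (m : ℕ) (f : Triplet I J → ℝ) :
    ∑ h : Fin (m + 1) → Triplet I J, Γ.cylinderProb k₁ σ τ (m + 1) h * f (h (Fin.last m)) =
      ∑ h : Fin m → Triplet I J, Γ.cylinderProb k₁ σ τ m h * ∑ l, Γ.stateProb k₁ m h l *
        ((σ m h l).1 ⬝ᵥ (Matrix.of fun i j => f ⟨l, i, j⟩).mulVec (τ m h l).1) := by
  rw [← (Fin.snocEquiv fun _ => Triplet I J).sum_comp, Fintype.sum_prod_type, Finset.sum_comm]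
  refine Finset.sum_congr rfl fun h _ => ?_
  simp only [Fin.snocEquiv, Equiv.coe_fn_mk, Fin.snoc_last,
    Γ.cylinderProb_succ_eq k₁ σ τ (Fin.init_snoc (α := fun _ => Triplet I J) _ _)
      (Fin.snoc_last (α := fun _ => Triplet I J) _ _)]
  rw [Fintype.sum_sigma, Finset.mul_sum]
  refine Finset.sum_congr rfl fun l _ => ?_
  rw [Fintype.sum_prod_type]
  simp only [dotProduct, Matrix.mulVec, Matrix.of_apply, Finset.mul_sum]
  exact Finset.sum_congr rfl fun i _ => Finset.sum_congr rfl fun j _ => by ring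

lemma sum_cylinderProb (m : ℕ) : ∑ h, Γ.cylinderProb k₁ σ τ m h = 1 := by
  induction m with
  | zero => simp [cylinderProb]
  | succ m ih =>
    have h1 := Γ.sum_cylinderProb_succ_mul k₁ σ τ m fun _ => 1
    simp only [mul_one] at h1
    refine h1.trans (Eq.trans (Finset.sum_congr rfl fun h _ => ?_) ih)
    have h2 : ∀ l, (σ m h l).1 ⬝ᵥ (Matrix.of fun _ _ => (1 : ℝ)).mulVec (τ m h l).1 = 1 :=
      fun l => by
        simp only [dotProduct, Matrix.mulVec, Matrix.of_apply, one_mul]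
        rw [← Finset.sum_mul, (σ m h l).2.2, (τ m h l).2.2, one_mul]
    simp only [h2, mul_one, sum_stateProb]

/-- The expectation of `z` at the state of stage `m + 1`. -/
def stateExpectation (z : Fin n → ℝ) (m : ℕ) : ℝ :=
  ∑ h : Fin m → Triplet I J, Γ.cylinderProb k₁ σ τ m h * ∑ l, Γ.stateProb k₁ m h l * z l

lemma stateExpectation_zero (z : Fin n → ℝ) : Γ.stateExpectation k₁ σ τ z 0 = z k₁ := by
  simp [stateExpectation, cylinderProb, stateProb]

lemma stage_add_stateExpectation (lam : ℝ) (z : Fin n → ℝ) (m : ℕ) :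
    lam * Γ.stageExpectation k₁ σ τ m + (1 - lam) * Γ.stateExpectation k₁ σ τ z (m + 1) =
      ∑ h : Fin m → Triplet I J, Γ.cylinderProb k₁ σ τ m h * ∑ l, Γ.stateProb k₁ m h l *
        ((σ m h l).1 ⬝ᵥ (Γ.localGame lam z l).mulVec (τ m h l).1) := by
  have h := Γ.sum_cylinderProb_succ_mul k₁ σ τ m fun t =>
    lam * Γ.g t.1 t.2.1 t.2.2 + (1 - lam) * ∑ l, Γ.q t.1 t.2.1 t.2.2 l * z l
  refine Eq.trans ?_ h
  rw [stageExpectation, stateExpectation, Finset.mul_sum, Finset.mul_sum,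
    ← Finset.sum_add_distrib]
  refine Finset.sum_congr rfl fun h _ => ?_
  simp only [stateProb]
  ring

lemma abs_stateExpectation_le {z : Fin n → ℝ} {c : ℝ} (hz : ∀ l, |z l| ≤ c) (m : ℕ) :
    |Γ.stateExpectation k₁ σ τ z m| ≤ c :=
  abs_sum_mul_le (Γ.cylinderProb_nonneg k₁ σ τ m) (Γ.sum_cylinderProb k₁ σ τ m) fun h =>
    abs_sum_mul_le (Γ.stateProb_nonneg k₁ m h) (Γ.sum_stateProb k₁ m h) hz

lemma abs_stageExpectation_le {c : ℝ} (hg : ∀ l i j, |Γ.g l i j| ≤ c) (m : ℕ) :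
    |Γ.stageExpectation k₁ σ τ m| ≤ c :=
  abs_sum_mul_le (Γ.cylinderProb_nonneg k₁ σ τ (m + 1)) (Γ.sum_cylinderProb k₁ σ τ (m + 1))
    fun _ => hg _ _ _

omit [∀ k, Fintype (I k)] [∀ k, Fintype (J k)] in
lemma exists_abs_g_le [∀ k, Finite (I k)] [∀ k, Finite (J k)] :
    ∃ c, ∀ l i j, |Γ.g l i j| ≤ c := by
  obtain ⟨c, hc⟩ := (Set.finite_range fun t : Triplet I J => |Γ.g t.1 t.2.1 t.2.2|).bddAbove
  exact ⟨c, fun l i j => hc ⟨⟨l, i, j⟩, rfl⟩⟩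

lemma summable_pow_mul_of_abs_le {lam : ℝ} (hlam : lam ∈ Set.Ioc (0 : ℝ) 1) {f : ℕ → ℝ} {c : ℝ}
    (hf : ∀ m, |f m| ≤ c) : Summable fun m => (1 - lam) ^ m * f m := by
  refine Summable.of_norm_bounded (g := fun m => (1 - lam) ^ m * c)
    ((summable_geometric_of_lt_one (by linarith [hlam.2]) (by linarith [hlam.1])).mul_right c)
    fun m => ?_
  have : 0 ≤ (1 - lam) ^ m := pow_nonneg (by linarith [hlam.2]) m
  rw [norm_mul, Real.norm_of_nonneg this]
  exact mul_le_mul_of_nonneg_left (hf m) this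

lemma hasSum_payoff {lam : ℝ} (hlam : lam ∈ Set.Ioc (0 : ℝ) 1) :
    HasSum (fun m => lam * (1 - lam) ^ m * Γ.stageExpectation k₁ σ τ m)
      (Γ.payoff lam k₁ σ τ) := by
  obtain ⟨c, hc⟩ := Γ.exists_abs_g_le
  refine Summable.hasSum ?_
  simp only [mul_assoc]
  exact (summable_pow_mul_of_abs_le hlam (Γ.abs_stageExpectation_le k₁ σ τ hc)).mul_left lam

/-- The continuation terms telescope, leaving `-z k₁`; one-stage inequalities thereby become
inequalities for the whole payoff. -/
lemma hasSum_payoff_sub {lam : ℝ} (hlam : lam ∈ Set.Ioc (0 : ℝ) 1) (z : Fin n → ℝ) :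
    HasSum (fun m => (1 - lam) ^ m * (lam * Γ.stageExpectation k₁ σ τ m +
      (1 - lam) * Γ.stateExpectation k₁ σ τ z (m + 1) - Γ.stateExpectation k₁ σ τ z m))
      (Γ.payoff lam k₁ σ τ - z k₁) := by
  obtain ⟨c, hc⟩ := (Set.finite_range fun l => |z l|).bddAbove
  have hb := (summable_pow_mul_of_abs_le hlam
    (Γ.abs_stateExpectation_le k₁ σ τ fun l => hc ⟨l, rfl⟩)).hasSum
  have hb' := (hasSum_nat_add_iff' 1).mpr hb
  have := (Γ.hasSum_payoff k₁ σ τ hlam).add (hb'.sub hb)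
  convert this using 1
  · ext m; ring
  · simp [stateExpectation_zero]; ring

lemma le_payoff {lam : ℝ} (hlam : lam ∈ Set.Ioc (0 : ℝ) 1) {z : Fin n → ℝ}
    (hz : ∀ m h l, z l ≤ (σ m h l).1 ⬝ᵥ (Γ.localGame lam z l).mulVec (τ m h l).1) :
    z k₁ ≤ Γ.payoff lam k₁ σ τ := by
  rw [← sub_nonneg]
  refine (Γ.hasSum_payoff_sub k₁ σ τ hlam z).nonneg fun m => ?_
  refine mul_nonneg (pow_nonneg (by linarith [hlam.2]) m) (sub_nonneg.mpr ?_)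
  rw [stage_add_stateExpectation]
  exact Finset.sum_le_sum fun h _ => mul_le_mul_of_nonneg_left (Finset.sum_le_sum fun l _ =>
    mul_le_mul_of_nonneg_left (hz m h l) (Γ.stateProb_nonneg _ _ _ _))
    (Γ.cylinderProb_nonneg _ _ _ _ _)

lemma payoff_le {lam : ℝ} (hlam : lam ∈ Set.Ioc (0 : ℝ) 1) {z : Fin n → ℝ}
    (hz : ∀ m h l, (σ m h l).1 ⬝ᵥ (Γ.localGame lam z l).mulVec (τ m h l).1 ≤ z l) :
    Γ.payoff lam k₁ σ τ ≤ z k₁ := by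
  rw [← sub_nonpos]
  refine (Γ.hasSum_payoff_sub k₁ σ τ hlam z).nonpos fun m => ?_
  refine mul_nonpos_of_nonneg_of_nonpos (pow_nonneg (by linarith [hlam.2]) m)
    (sub_nonpos.mpr ?_)
  rw [stage_add_stateExpectation]
  exact Finset.sum_le_sum fun h _ => mul_le_mul_of_nonneg_left (Finset.sum_le_sum fun l _ =>
    mul_le_mul_of_nonneg_left (hz m h l) (Γ.stateProb_nonneg _ _ _ _))
    (Γ.cylinderProb_nonneg _ _ _ _ _)

lemma bddBelow_range_payoff {lam : ℝ} (hlam : lam ∈ Set.Ioc (0 : ℝ) 1) :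
    BddBelow (Set.range fun τ : Strategy I J J => Γ.payoff lam k₁ σ τ) := by
  obtain ⟨c, hc⟩ := Γ.exists_abs_g_le
  refine ⟨-c, ?_⟩
  rintro _ ⟨τ, rfl⟩
  -- A constant continuation payoff below all stage payoffs satisfies the one-stage inequality.
  refine Γ.le_payoff k₁ σ τ hlam (z := fun _ => -c) fun m h l => ?_
  refine le_dotProduct_of_mem_stdSimplex (σ m h l).2 fun i => ?_
  rw [Matrix.mulVec, dotProduct_comm]
  refine le_dotProduct_of_mem_stdSimplex (τ m h l).2 fun j => ?_
  simp only [localGame, Matrix.of_apply, ← Finset.sum_mul, Γ.q_sum]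
  nlinarith [hlam.1, (abs_le.mp (hc l i j)).1]

end Play

/-! ### The value as fixed point of the Shapley operator, its bounds and its continuity. -/

variable [∀ k, Nonempty (I k)] [∀ k, Nonempty (J k)]

/-- The stationary strategies that are optimal in the local games guarantee `z` to each player. -/
lemma value_eq_of_fixedPoint {lam : ℝ} (hlam : lam ∈ Set.Ioc (0 : ℝ) 1) {z : Fin n → ℝ}
    (hz : ∀ k, gameVal (Γ.localGame lam z k) = z k) (k : Fin n) : Γ.value lam k = z k := by
  choose x hx using fun k => (exists_optimal (Γ.localGame lam z k)).1
  choose y hy using fun k => (exists_optimal (Γ.localGame lam z k)).2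
  let σ₀ : Strategy I J I := fun _ _ l => ⟨x l, (hx l).1⟩
  let τ₀ : Strategy I J J := fun _ _ l => ⟨y l, (hy l).1⟩
  have : Nonempty (Strategy I J I) := ⟨σ₀⟩
  have : Nonempty (Strategy I J J) := ⟨τ₀⟩
  have key : ∀ σ, (⨅ τ, Γ.payoff lam k σ τ) ≤ z k := fun σ =>
    (ciInf_le (Γ.bddBelow_range_payoff k σ hlam) τ₀).trans
      (Γ.payoff_le k σ τ₀ hlam fun m h l => ((hy l).2 _ (σ m h l).2).trans (hz l).le)
  refine le_antisymm (ciSup_le key) ?_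
  refine le_trans (le_ciInf fun τ => ?_) (le_ciSup (f := fun σ => ⨅ τ, Γ.payoff lam k σ τ)
    ⟨z k, ?_⟩ σ₀)
  · exact Γ.le_payoff k σ₀ τ hlam fun m h l => (hz l).ge.trans ((hx l).2 _ (τ m h l).2)
  · rintro _ ⟨σ, rfl⟩
    exact key σ

omit [∀ k, Fintype (I k)] [∀ k, Fintype (J k)] [∀ k, Nonempty (I k)] [∀ k, Nonempty (J k)] in
lemma abs_sum_q_mul_sub_le (z w : Fin n → ℝ) (k : Fin n) (i : I k) (j : J k) :
    |∑ l, Γ.q k i j l * (z l - w l)| ≤ dist z w :=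
  abs_sum_mul_le (Γ.q_nonneg k i j) (Γ.q_sum k i j) fun l => by
    rw [← Real.dist_eq]; exact dist_le_pi_dist z w l

lemma exists_fixedPoint {lam : ℝ} (hlam : lam ∈ Set.Ioc (0 : ℝ) 1) :
    ∃ z : Fin n → ℝ, ∀ k, gameVal (Γ.localGame lam z k) = z k := by
  have hK : (0 : ℝ) ≤ 1 - lam := by linarith [hlam.2]
  have hc : ContractingWith (1 - lam).toNNReal fun (z : Fin n → ℝ) k =>
      gameVal (Γ.localGame lam z k) := by
    refine ⟨?_, LipschitzWith.of_dist_le_mul fun z w => ?_⟩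
    · rw [← NNReal.coe_lt_coe, Real.coe_toNNReal _ hK, NNReal.coe_one]
      linarith [hlam.1]
    · refine (dist_pi_le_iff (by positivity)).mpr fun k => ?_
      rw [Real.dist_eq]
      refine abs_gameVal_sub_le fun i j => ?_
      have : Γ.localGame lam z k i j - Γ.localGame lam w k i j =
          (1 - lam) * ∑ l, Γ.q k i j l * (z l - w l) := by
        simp only [localGame, Matrix.of_apply, mul_sub, Finset.sum_sub_distrib]
        ring
      rw [this, abs_mul, abs_of_nonneg hK, Real.coe_toNNReal _ hK]
      exact mul_le_mul_of_nonneg_left (Γ.abs_sum_q_mul_sub_le z w k i j) hK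
  exact ⟨hc.fixedPoint _, fun k => congrFun hc.fixedPoint_isFixedPt k⟩

theorem gameVal_localGame_value {lam : ℝ} (hlam : lam ∈ Set.Ioc (0 : ℝ) 1) (k : Fin n) :
    gameVal (Γ.localGame lam (Γ.value lam) k) = Γ.value lam k := by
  obtain ⟨z, hz⟩ := Γ.exists_fixedPoint hlam
  have : Γ.value lam = z := funext fun k => Γ.value_eq_of_fixedPoint hlam hz k
  rw [this, hz]

omit [∀ k, Nonempty (I k)] [∀ k, Nonempty (J k)] in
lemma g_le_maxPayoff (k : Fin n) (i : I k) (j : J k) : Γ.g k i j ≤ Γ.maxPayoff :=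
  le_ciSup (f := fun t : Triplet I J => Γ.g t.1 t.2.1 t.2.2) (Set.finite_range _).bddAbove
    ⟨k, i, j⟩

omit [∀ k, Nonempty (I k)] [∀ k, Nonempty (J k)] in
lemma minPayoff_le_g (k : Fin n) (i : I k) (j : J k) : Γ.minPayoff ≤ Γ.g k i j :=
  ciInf_le (f := fun t : Triplet I J => Γ.g t.1 t.2.1 t.2.2) (Set.finite_range _).bddBelow
    ⟨k, i, j⟩

lemma value_mem_Icc {lam : ℝ} (hlam : lam ∈ Set.Ioc (0 : ℝ) 1) (k : Fin n) :
    Γ.value lam k ∈ Set.Icc Γ.minPayoff Γ.maxPayoff := by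
  have : Nonempty (Fin n) := ⟨k⟩
  have hK : (0 : ℝ) ≤ 1 - lam := by linarith [hlam.2]
  constructor
  -- In the worst state the continuation payoff is at least the value of that state itself.
  · obtain ⟨l, hl⟩ := Finite.exists_min (Γ.value lam)
    refine le_trans ?_ (hl k)
    have h1 : lam * Γ.minPayoff + (1 - lam) * Γ.value lam l ≤ Γ.value lam l := by
      conv_rhs => rw [← Γ.gameVal_localGame_value hlam l]
      refine le_gameVal_of_le fun i j => add_le_add
        (mul_le_mul_of_nonneg_left (Γ.minPayoff_le_g l i j) hlam.1.le)
        (mul_le_mul_of_nonneg_left ?_ hK)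
      exact le_dotProduct_of_mem_stdSimplex ⟨Γ.q_nonneg l i j, Γ.q_sum l i j⟩ hl
    nlinarith [hlam.1]
  · obtain ⟨l, hl⟩ := Finite.exists_max (Γ.value lam)
    refine (hl k).trans ?_
    have h1 : Γ.value lam l ≤ lam * Γ.maxPayoff + (1 - lam) * Γ.value lam l := by
      conv_lhs => rw [← Γ.gameVal_localGame_value hlam l]
      refine gameVal_le_of_le fun i j => add_le_add
        (mul_le_mul_of_nonneg_left (Γ.g_le_maxPayoff l i j) hlam.1.le)
        (mul_le_mul_of_nonneg_left ?_ hK)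
      exact dotProduct_le_of_mem_stdSimplex ⟨Γ.q_nonneg l i j, Γ.q_sum l i j⟩ hl
    nlinarith [hlam.1]

/-- Compare the two fixed-point equations: the operator at `mu` contracts by `1 - mu`, and changing
the discount factor costs at most `|lam - mu|` times the payoff range. -/
lemma mul_dist_value_le {lam mu : ℝ} (hlam : lam ∈ Set.Ioc (0 : ℝ) 1)
    (hmu : mu ∈ Set.Ioc (0 : ℝ) 1) :
    mu * dist (Γ.value lam) (Γ.value mu) ≤ |lam - mu| * |Γ.maxPayoff - Γ.minPayoff| := by
  have hK : (0 : ℝ) ≤ 1 - mu := by linarith [hmu.2]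
  have : dist (Γ.value lam) (Γ.value mu) ≤ |lam - mu| * |Γ.maxPayoff - Γ.minPayoff| +
      (1 - mu) * dist (Γ.value lam) (Γ.value mu) := by
    refine (dist_pi_le_iff (by positivity)).mpr fun k => ?_
    rw [Real.dist_eq]
    conv_lhs => rw [← Γ.gameVal_localGame_value hlam k, ← Γ.gameVal_localGame_value hmu k]
    refine abs_gameVal_sub_le fun i j => ?_
    have h1 : Γ.localGame lam (Γ.value lam) k i j - Γ.localGame mu (Γ.value mu) k i j =
        (lam - mu) * (Γ.g k i j - ∑ l, Γ.q k i j l * Γ.value lam l) +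
          (1 - mu) * ∑ l, Γ.q k i j l * (Γ.value lam l - Γ.value mu l) := by
      simp only [localGame, Matrix.of_apply, mul_sub, Finset.sum_sub_distrib]
      ring
    rw [h1]
    refine (abs_add_le _ _).trans (add_le_add ?_ ?_)
    · rw [abs_mul]
      refine mul_le_mul_of_nonneg_left ?_ (abs_nonneg _)
      have hq : Γ.q k i j ∈ stdSimplex ℝ (Fin n) := ⟨Γ.q_nonneg k i j, Γ.q_sum k i j⟩
      have h2 : Γ.minPayoff ≤ ∑ l, Γ.q k i j l * Γ.value lam l :=
        le_dotProduct_of_mem_stdSimplex hq fun l => (Γ.value_mem_Icc hlam l).1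
      have h3 : ∑ l, Γ.q k i j l * Γ.value lam l ≤ Γ.maxPayoff :=
        dotProduct_le_of_mem_stdSimplex hq fun l => (Γ.value_mem_Icc hlam l).2
      refine le_trans ?_ (le_abs_self _)
      rw [abs_le]
      constructor <;> linarith [Γ.g_le_maxPayoff k i j, Γ.minPayoff_le_g k i j]
    · rw [abs_mul, abs_of_nonneg hK]
      exact mul_le_mul_of_nonneg_left (Γ.abs_sum_q_mul_sub_le _ _ k i j) hK
  linarith

lemma continuousOn_value (k : Fin n) :
    ContinuousOn (fun lam => Γ.value lam k) (Set.Ioc (0 : ℝ) 1) := by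
  intro mu hmu
  rw [ContinuousWithinAt, tendsto_iff_dist_tendsto_zero]
  have ht : Tendsto (fun lam => |lam - mu| * |Γ.maxPayoff - Γ.minPayoff| / mu)
      (𝓝[Set.Ioc 0 1] mu) (𝓝 0) := by
    have hcont : Continuous fun lam => |lam - mu| * |Γ.maxPayoff - Γ.minPayoff| / mu := by
      fun_prop
    have := hcont.tendsto mu
    simp only [sub_self, abs_zero, zero_mul, zero_div] at this
    exact this.mono_left nhdsWithin_le_nhds
  refine squeeze_zero' (Eventually.of_forall fun _ => dist_nonneg) ?_ ht
  filter_upwards [self_mem_nhdsWithin] with lam hlam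
  refine (dist_le_pi_dist (Γ.value lam) (Γ.value mu) k).trans ?_
  rw [le_div_iff₀ hmu.1, mul_comm]
  exact Γ.mul_dist_value_le hlam hmu

end StochasticGame

/-! ### Bivariate polynomials near the axis -/

lemma continuous_eval_eval (P : ℝ[X][X]) :
    Continuous fun p : ℝ × ℝ => (P.eval (C p.1)).eval p.2 := by
  simp only [eval_eq_sum_range (p := P), eval_finsetSum, eval_mul, eval_pow, eval_C]
  exact continuous_finsetSum _ fun s _ =>
    ((P.coeff s).continuous.comp continuous_snd).mul (continuous_fst.pow s)

namespace StochasticGame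

lemma lowestCoeff_ne_zero {P : ℝ[X][X]} (hP : P ≠ 0) : lowestCoeff P ≠ 0 :=
  mt trailingCoeff_eq_zero.mp hP

/-- Dividing by the largest power of the discount factor does not affect zeros with `λ > 0`; the
quotient at `λ = 0` is `φ(P)`, and continuity passes to the limit. -/
lemma lowestCoeff_isRoot {P : ℝ[X][X]} {f : ℝ → ℝ} {w : ℝ} (hf : Tendsto f (𝓝[>] 0) (𝓝 w))
    (h : ∃ᶠ lam in 𝓝[>] (0 : ℝ), (P.eval (C lam)).eval (f lam) = 0) :
    (lowestCoeff P).IsRoot w := by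
  obtain ⟨Q, hQ⟩ := X_pow_dvd_iff.mpr fun d (hd : d < P.natTrailingDegree) =>
    coeff_eq_zero_of_lt_natTrailingDegree hd
  have hcoeff : lowestCoeff P = Q.coeff 0 := by
    have h1 := coeff_X_pow_mul Q P.natTrailingDegree 0
    rw [← hQ, zero_add] at h1
    exact h1
  have hQ0 : ∃ᶠ lam in 𝓝[>] (0 : ℝ), (Q.eval (C lam)).eval (f lam) = 0 := by
    refine (h.and_eventually self_mem_nhdsWithin).mono fun lam hlam => ?_
    have h1 := hlam.1
    rw [hQ] at h1
    simp only [eval_mul, eval_pow, eval_X, eval_C] at h1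
    exact (mul_eq_zero.mp h1).resolve_left (pow_ne_zero _ (ne_of_gt hlam.2))
  have ht : Tendsto (fun lam => (Q.eval (C lam)).eval (f lam)) (𝓝[>] 0)
      (𝓝 ((Q.eval (C 0)).eval w)) :=
    ((continuous_eval_eval Q).tendsto (0, w)).comp
      ((tendsto_id.mono_left nhdsWithin_le_nhds).prodMk_nhds hf)
  have h0 : (Q.eval (C 0)).eval w = 0 := by
    by_contra hne
    obtain ⟨lam, h1, h2⟩ := (hQ0.and_eventually (ht.eventually_ne hne)).exists
    exact h2 h1
  rw [hcoeff, IsRoot, coeff_zero_eq_eval_zero]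
  simpa using h0

end StochasticGame

/-- Each coefficient in `w` beyond degree `d` is a polynomial in the discount factor vanishing at
every real. -/
lemma natDegree_coeff_le_of_eval {P : ℝ[X][X]} {d : ℕ}
    (h : ∀ t : ℝ, (P.eval (C t)).natDegree ≤ d) (s : ℕ) : (P.coeff s).natDegree ≤ d := by
  rw [natDegree_le_iff_coeff_eq_zero]
  intro e he
  let p : ℝ[X] := ∑ s ∈ Finset.range (P.natDegree + 1), C ((P.coeff s).coeff e) * X ^ s
  have hp : p = 0 := by
    refine Polynomial.funext fun t => ?_
    have h1 := natDegree_le_iff_coeff_eq_zero.mp (h t) e he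
    rw [eval_eq_sum_range] at h1
    simp only [finsetSum_coeff, ← C_pow, coeff_mul_C] at h1
    simpa [p, eval_finsetSum] using h1
  have h2 : p.coeff s = (P.coeff s).coeff e := by
    simp only [p, finsetSum_coeff, coeff_C_mul, coeff_X_pow, mul_ite, mul_one, mul_zero,
      Finset.sum_ite_eq, Finset.mem_range]
    split_ifs with hs
    · rfl
    · rw [coeff_eq_zero_of_natDegree_lt (p := P) (by omega), coeff_zero]
  rw [← h2, hp, coeff_zero]

/-- A minor witnessing the largest rank is a nonzero polynomial in the parameter, so it has no zeros
close to `0` on the right. -/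
lemma eventually_rank_map_eval_le {A B : Type*} [Fintype A] [Fintype B] (M : Matrix A B ℝ[X]) :
    ∀ᶠ lam in 𝓝[>] (0 : ℝ), ∀ t : ℝ,
      (M.map (evalRingHom t)).rank ≤ (M.map (evalRingHom lam)).rank := by
  have hbdd : BddAbove (Set.range fun t : ℝ => (M.map (evalRingHom t)).rank) := by
    refine ⟨Fintype.card B, ?_⟩
    rintro _ ⟨t, rfl⟩
    exact Matrix.rank_le_card_width _
  obtain ⟨t₀, ht₀⟩ := Nat.sSup_mem (Set.range_nonempty _) hbdd
  obtain ⟨r, c, -, h, -⟩ := exists_minor_rank (M.map (evalRingHom t₀))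
  have heval : ∀ t, (M.submatrix r c).det.eval t =
      ((M.map (evalRingHom t)).submatrix r c).det := fun t => by
    rw [← coe_evalRingHom, RingHom.map_det]
    rfl
  have hne : (M.submatrix r c).det ≠ 0 := fun h0 => h (by rw [← heval, h0, eval_zero])
  have hev : ∀ᶠ lam in 𝓝[>] (0 : ℝ), ¬ (M.submatrix r c).det.IsRoot lam :=
    ((nhdsGT_le_nhdsNE (0 : ℝ)).trans (nhdsNE_le_cofinite 0))
      (finite_setOfPred_isRoot hne).compl_mem_cofinite
  filter_upwards [hev] with lam hlam t
  refine le_trans (le_csSup hbdd ⟨t, rfl⟩) (ht₀.symm.le.trans ?_)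
  refine card_le_rank_of_minor_ne_zero (r := r) (c := c) ?_
  rw [← heval]
  exact hlam

lemma exists_mem_frequently_of_finite {α β : Type*} {l : Filter α} {S : Set β} (hS : S.Finite)
    {p : β → α → Prop} (h : ∃ᶠ a in l, ∃ b ∈ S, p b a) : ∃ b ∈ S, ∃ᶠ a in l, p b a := by
  by_contra! hc
  refine h ?_
  have := (eventually_all_finite hS).mpr fun b hb => hc b hb
  filter_upwards [this] with a ha
  rintro ⟨b, hb, hab⟩
  exact ha b hb hab

lemma frequently_eq_of_continuousOn {f : ℝ → ℝ} {a b c : ℝ}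
    (hf : ContinuousOn f (Set.Ioc (0 : ℝ) 1)) (hac : a < c) (hcb : c < b)
    (ha : ∃ᶠ t in 𝓝[>] (0 : ℝ), f t < a) (hb : ∃ᶠ t in 𝓝[>] (0 : ℝ), b < f t) :
    ∃ᶠ t in 𝓝[>] (0 : ℝ), f t = c := by
  rw [frequently_iff]
  intro U hU
  obtain ⟨u, hu, hUu⟩ := mem_nhdsGT_iff_exists_Ioo_subset.mp hU
  have hu' : Set.Ioo 0 (min u 1) ∈ 𝓝[>] (0 : ℝ) :=
    Ioo_mem_nhdsGT (lt_min hu one_pos)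
  obtain ⟨s, hs, hsU⟩ := (ha.and_eventually hu').exists
  obtain ⟨t, ht, htU⟩ := (hb.and_eventually hu').exists
  have hsub : Set.uIcc s t ⊆ Set.Ioo 0 (min u 1) := Set.ordConnected_Ioo.uIcc_subset hsU htU
  obtain ⟨z, hz, hzc⟩ := intermediate_value_uIcc (hf.mono (hsub.trans fun z hz =>
    ⟨hz.1, (hz.2.trans_le (min_le_right _ _)).le⟩))
    (Set.mem_uIcc.mpr (Or.inl ⟨(hs.trans hac).le, (hcb.trans ht).le⟩))
  exact ⟨z, hUu ⟨(hsub hz).1, (hsub hz).2.trans_le (min_le_left _ _)⟩, hzc⟩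

/-! ### The limit of the discounted values -/

namespace StochasticGame

variable {n : ℕ} {I J : Fin n → Type*} [∀ k, Fintype (I k)] [∀ k, Fintype (J k)]
  (Γ : StochasticGame n I J)

/-- The nonzero minors of the pencil of degree at most `d` in the second variable. -/
def boundedMinors (k : Fin n) (d : ℕ) : Set ℝ[X][X] :=
  {P | P ≠ 0 ∧ (∀ s, (P.coeff s).natDegree ≤ d) ∧
    ∃ (m : ℕ) (r : Fin m ↪ ∀ l, I l) (c : Fin m ↪ ∀ l, J l), 0 < m ∧
      P = ((Γ.pencil k).submatrix r c).det}

lemma finite_minors (k : Fin n) : {P : ℝ[X][X] | ∃ (m : ℕ) (r : Fin m ↪ ∀ l, I l)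
    (c : Fin m ↪ ∀ l, J l), P = ((Γ.pencil k).submatrix r c).det}.Finite := by
  classical
  refine ((Set.finite_Iic (Fintype.card (∀ l, I l))).biUnion fun m _ => Set.finite_range
    fun rc : (Fin m ↪ ∀ l, I l) × (Fin m ↪ ∀ l, J l) =>
      ((Γ.pencil k).submatrix rc.1 rc.2).det).subset ?_
  rintro _ ⟨m, r, c, rfl⟩
  refine Set.mem_biUnion (x := m) ?_ ⟨(r, c), rfl⟩
  simpa using Fintype.card_le_of_embedding r

lemma finite_boundedMinors (k : Fin n) (d : ℕ) : (Γ.boundedMinors k d).Finite :=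
  (Γ.finite_minors k).subset fun _ ⟨_, _, m, r, c, _, h⟩ => ⟨m, r, c, h⟩

lemma finite_roots_lowestCoeff {S : Set ℝ[X][X]} (hS : S.Finite) (h0 : ∀ P ∈ S, P ≠ 0) :
    {w : ℝ | ∃ P ∈ S, (lowestCoeff P).IsRoot w}.Finite := by
  refine (hS.biUnion fun P hP =>
    finite_setOfPred_isRoot (lowestCoeff_ne_zero (h0 P hP))).subset ?_
  rintro w ⟨P, hP, hw⟩
  exact Set.mem_biUnion hP hw

lemma rootSet_finite {lam : ℝ} (κ : Γ.KernelChoice lam) (k : Fin n) : (rootSet κ k).Finite :=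
  (finite_roots_lowestCoeff (Γ.finite_boundedMinors k κ.reducedDelta0.rank)
    fun _ hP => hP.1).subset fun _ hw => hw.2

lemma eventually_rank_reduced_le : ∀ᶠ lam in 𝓝[>] (0 : ℝ),
    ∀ (size : Fin n → ℕ) (row : ∀ k, Fin (size k) ↪ I k) (col : ∀ k, Fin (size k) ↪ J k) (t : ℝ),
      ((auxMatrix (Γ.dataArray t) 0).submatrix (Pi.map fun k => row k)
        (Pi.map fun k => col k)).rank ≤
      ((auxMatrix (Γ.dataArray lam) 0).submatrix (Pi.map fun k => row k)
        (Pi.map fun k => col k)).rank := by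
  -- Bounding the sizes makes the index type finite, so that one neighbourhood of `0` serves all
  -- choices of rows and columns.
  have key : ∀ d : Σ s : ∀ k, Fin (Fintype.card (I k) + 1),
      (∀ k, Fin (s k) ↪ I k) × (∀ k, Fin (s k) ↪ J k), ∀ᶠ lam in 𝓝[>] (0 : ℝ), ∀ t : ℝ,
      ((auxMatrix (Γ.dataArray t) 0).submatrix (Pi.map fun k => d.2.1 k)
        (Pi.map fun k => d.2.2 k)).rank ≤
      ((auxMatrix (Γ.dataArray lam) 0).submatrix (Pi.map fun k => d.2.1 k)
        (Pi.map fun k => d.2.2 k)).rank := fun d => by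
    have := eventually_rank_map_eval_le ((auxMatrix (Γ.dataArray (X : ℝ[X])) 0).submatrix
      (Pi.map fun k => d.2.1 k) (Pi.map fun k => d.2.2 k))
    simpa only [← Matrix.submatrix_map, map_eval_auxMatrix] using this
  filter_upwards [eventually_all.mpr key] with lam hlam size row col t
  exact hlam ⟨fun k => ⟨size k, Nat.lt_succ_of_le
    (by simpa using Fintype.card_le_of_embedding (row k))⟩, row, col⟩ t

lemma rank_reducedDelta0_le {lam : ℝ} (κ : Γ.KernelChoice lam) :
    κ.reducedDelta0.rank ≤ Fintype.card (∀ l, J l) := by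
  refine (Matrix.rank_le_card_width _).trans (Fintype.card_le_of_injective
    (Pi.map fun k => (κ.col k : Fin (κ.size k) → J k)) ?_)
  exact Function.Injective.piMap fun k => (κ.col k).injective

variable [∀ k, Nonempty (I k)] [∀ k, Nonempty (J k)]

lemma nonempty_kernelChoice (lam : ℝ) : Nonempty (Γ.KernelChoice lam) := by
  choose size row col h using fun k =>
    exists_shapleySnowKernel (Γ.localGame lam (Γ.value lam) k)
  exact ⟨⟨size, row, col, h⟩⟩

lemma eventually_exists_charPoly_root (k : Fin n) : ∀ᶠ lam in 𝓝[>] (0 : ℝ),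
    ∀ κ : Γ.KernelChoice lam, ∃ P ∈ charPolys κ k,
      (P.eval (C lam)).eval (Γ.value lam k) = 0 := by
  filter_upwards [Γ.eventually_rank_reduced_le, Ioc_mem_nhdsGT one_pos] with lam hrank hlam κ
  obtain ⟨m, r, c, hm, hne, hroot, hdeg⟩ := Γ.exists_minor_pencil_root hlam
    (fun k => Γ.gameVal_localGame_value hlam k) κ.row κ.col κ.isKernel k
  refine ⟨_, ⟨hne, natDegree_coeff_le_of_eval fun t => ?_, m, r, c, hm, rfl⟩, hroot⟩
  refine (hdeg t).trans ((hrank _ κ.row κ.col t).trans (le_of_eq ?_))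
  rw [KernelChoice.reducedDelta0, auxMatrix_submatrix (Γ.dataArray lam) 0
    (fun k => (κ.row k : Fin (κ.size k) → I k)) fun k => (κ.col k : Fin (κ.size k) → J k)]

lemma exists_tendsto_value (k : Fin n) :
    ∃ v₀, Tendsto (fun lam => Γ.value lam k) (𝓝[>] 0) (𝓝 v₀) := by
  have hIoc : Set.Ioc (0 : ℝ) 1 ∈ 𝓝[>] (0 : ℝ) := Ioc_mem_nhdsGT one_pos
  set S := {P : ℝ[X][X] | P ≠ 0 ∧ ∃ (m : ℕ) (r : Fin m ↪ ∀ l, I l) (c : Fin m ↪ ∀ l, J l),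
    P = ((Γ.pencil k).submatrix r c).det}
  have hS : S.Finite := (Γ.finite_minors k).subset fun P hP => hP.2
  refine tendsto_of_no_upcrossings dense_univ (fun a _ b _ hab => ?_)
    (isBoundedUnder_of_eventually_le (a := Γ.maxPayoff) ?_)
    (isBoundedUnder_of_eventually_ge (a := Γ.minPayoff) ?_)
  · rintro ⟨ha, hb⟩
    -- A level in the gap that is not a root of any `φ(P)`; the degree bound plays no role here.
    obtain ⟨c, hc, hcS⟩ := ((Set.Ioo_infinite hab).sdiff
      (finite_roots_lowestCoeff hS fun P hP => hP.1)).nonempty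
    have hfreq := frequently_eq_of_continuousOn (Γ.continuousOn_value k) hc.1 hc.2 ha hb
    obtain ⟨P, hP, hPc⟩ := exists_mem_frequently_of_finite hS
      (p := fun P lam => (P.eval (C lam)).eval c = 0)
      ((hfreq.and_eventually (Γ.eventually_exists_charPoly_root k)).mono fun lam hlam => by
        obtain ⟨P, ⟨hP, -, m, r, c', -, hdet⟩, h0⟩ :=
          hlam.2 (Γ.nonempty_kernelChoice lam).some
        exact ⟨P, ⟨hP, m, r, c', hdet⟩, hlam.1 ▸ h0⟩)
    exact hcS ⟨P, hP, lowestCoeff_isRoot tendsto_const_nhds hPc⟩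
  · filter_upwards [hIoc] with lam hlam using (Γ.value_mem_Icc hlam k).2
  · filter_upwards [hIoc] with lam hlam using (Γ.value_mem_Icc hlam k).1

/-- The set `V^k` sees the kernels only through the rank `d`. A rank that recurs for arbitrarily
small `λ` yields, by finiteness, one minor of degree at most `d` vanishing along such `λ`, hence a
root at the limit. A rank that does not recur is excluded for small `λ`, and only finitely many
ranks occur. -/
lemma eventually_limit_mem_rootSet {k : Fin n} {v₀ : ℝ}
    (hv : Tendsto (fun lam => Γ.value lam k) (𝓝[>] 0) (𝓝 v₀)) :
    ∀ᶠ lam in 𝓝[>] (0 : ℝ), ∀ κ : Γ.KernelChoice lam, v₀ ∈ rootSet κ k := by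
  have hIcc : v₀ ∈ Set.Icc Γ.minPayoff Γ.maxPayoff := by
    refine isClosed_Icc.mem_of_tendsto hv ?_
    filter_upwards [Ioc_mem_nhdsGT one_pos] with lam hlam using Γ.value_mem_Icc hlam k
  have key : ∀ d ∈ Set.Iic (Fintype.card (∀ l, J l)), ∀ᶠ lam in 𝓝[>] (0 : ℝ),
      ∀ κ : Γ.KernelChoice lam, κ.reducedDelta0.rank = d →
        ∃ P ∈ Γ.boundedMinors k d, (lowestCoeff P).IsRoot v₀ := fun d _ => by
    by_cases hd : ∃ᶠ lam in 𝓝[>] (0 : ℝ), ∃ κ : Γ.KernelChoice lam, κ.reducedDelta0.rank = d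
    · obtain ⟨P, hP, hPv⟩ := exists_mem_frequently_of_finite (Γ.finite_boundedMinors k d)
        (p := fun P lam => (P.eval (C lam)).eval (Γ.value lam k) = 0)
        ((hd.and_eventually (Γ.eventually_exists_charPoly_root k)).mono fun lam hlam => by
          obtain ⟨⟨κ, rfl⟩, h⟩ := hlam
          exact h κ)
      exact Eventually.of_forall fun _ _ _ => ⟨P, hP, lowestCoeff_isRoot hv hPv⟩
    · filter_upwards [not_frequently.mp hd] with lam hlam κ hκ using absurd ⟨κ, hκ⟩ hlam
  filter_upwards [(eventually_all_finite (Set.finite_Iic _)).mpr key] with lam hlam κ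
  exact ⟨hIcc, hlam _ (Γ.rank_reducedDelta0_le κ) κ rfl⟩

end StochasticGame

theorem proposition4p1 {n : ℕ} {I J : Fin n → Type*}
    [∀ k, Fintype (I k)] [∀ k, Nonempty (I k)] [∀ k, Fintype (J k)] [∀ k, Nonempty (J k)]
    (Γ : StochasticGame n I J) (k : Fin n) :
    ∃ v₀ : ℝ, Tendsto (fun lam : ℝ => Γ.value lam k) (𝓝[>] 0) (𝓝 v₀) ∧
      ∃ lam₀ ∈ Set.Ioc (0 : ℝ) 1, ∀ lam₁ ∈ Set.Ioo (0 : ℝ) lam₀,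
        Nonempty (Γ.KernelChoice lam₁) ∧
        ∀ κ : Γ.KernelChoice lam₁,
          (∀ w : ℝ, MapClusterPt w (𝓝[>] 0) (fun lam : ℝ => Γ.value lam k) →
            w ∈ StochasticGame.rootSet κ k) ∧
          (StochasticGame.rootSet κ k).Finite ∧
          v₀ ∈ StochasticGame.rootSet κ k := by
  obtain ⟨v₀, hv⟩ := Γ.exists_tendsto_value k
  obtain ⟨u, hu, hsub⟩ := mem_nhdsGT_iff_exists_Ioo_subset.mp (Γ.eventually_limit_mem_rootSet hv)
  refine ⟨v₀, hv, min u 1, ⟨lt_min hu one_pos, min_le_right _ _⟩, fun lam₁ hlam₁ =>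
    ⟨Γ.nonempty_kernelChoice lam₁, fun κ => ?_⟩⟩
  have hmem := hsub ⟨hlam₁.1, hlam₁.2.trans_le (min_le_left _ _)⟩ κ
  refine ⟨fun w hw => ?_, Γ.rootSet_finite κ k, hmem⟩
  -- A cluster point of a convergent function is its limit, the real line being Hausdorff.
  have : (𝓝 w ⊓ 𝓝 v₀).NeBot := ClusterPt.mono hw hv
  rwa [eq_of_nhds_neBot this]
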